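/- **Theorem.** The Stubborn problem can be solved in time $O(|G|^7)$, where $|G|=|V|+|E|$. The *Stubborn problem* is the following decision problem. The input is a finite undirected simple graph $G=(V,E)$ together with a list $\mathcal L(v)\subseteq\{1,2,3,4\}$ for every vertex $v\in V$. The question is whether there is a colouring $\phi:V\to\{1,2,3,4\}$ such that - $\phi(v)\in\mathcal L(v)$ for every $v\in V$, - $\phi^{-1}(4)$ is a clique of $G$, and - for every edge $uw\in E$ the set of colours $\phi(\{u,w\})=\{\phi(u),\phi(w)\}$ is none of $\{1\}$, $\{2\}$, $\{1,3\}$. Precisely: there are a single random access machine program $P$, a function $T:\mathbb N\to\mathbb N$ with $T(N)=O(N^7)$ and a constant $c$ such that on every instance, $P$ halts after at most $T(|G|)$ steps, with output $1$ if a colouring as above exists and with output $0$ if none exists. The input is given as the numbers $|V|$ and $|E|$, the list of each vertex (four words $0$ or $1$), and a list of the edges, each occurring exactly once, in any order, as a pair of vertex numbers. The machine has finitely many registers and a random access memory; its elementary instructions (loading a constant, copying a register, addition, truncated subtraction, multiplication, reading and writing memory at an address held in a register) and its tests (equality and comparison of two registers) take one step each, programs are built from these by sequencing, conditionals and while loops,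 and every number that is written during the computation is smaller than $(|G|+2)^c$, i.e. fits in a word of $O(\log|G|)$ bits. -/

import Mathlib

/-! ### The stubborn problem -/

/-- An instance on the vertex set `V`: an undirected graph together with a list
`lists v ⊆ {1, 2, 3, 4}` of admissible colours for every vertex `v`. -/
structure StubbornInstance (V : Type*) where
  graph : SimpleGraph V
  lists : V → Finset ℕ
  lists_subset : ∀ v, lists v ⊆ {1, 2, 3, 4}

namespace StubbornInstance

/-- `φ` is a feasible colouring: it respects the lists (so it takes values in `{1, 2, 3, 4}`),
the vertices of colour `4` form a clique, and the set of colours of the two ends of an edge is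
none of `{1}`, `{2}`, `{1, 3}`. -/
def IsSolution {V : Type*} (I : StubbornInstance V) (φ : V → ℕ) : Prop :=
  (∀ v, φ v ∈ I.lists v) ∧
  I.graph.IsClique (φ ⁻¹' {4}) ∧
  ∀ u w, I.graph.Adj u w →
    φ '' {u, w} ≠ {1} ∧ φ '' {u, w} ≠ {2} ∧ φ '' {u, w} ≠ {1, 3}

def Solvable {V : Type*} (I : StubbornInstance V) : Prop :=
  ∃ φ : V → ℕ, I.IsSolution φ

/-- The size `|G| = |V| + |E|`. -/
noncomputable def size {n : ℕ} (I : StubbornInstance (Fin n)) : ℕ :=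
  n + I.graph.edgeSet.ncard

/-- `es` lists every edge of the graph exactly once; the order of the edges and the order of the
two ends of each edge are arbitrary. -/
def IsEdgeList {n : ℕ} (I : StubbornInstance (Fin n)) (es : List (Fin n × Fin n)) : Prop :=
  (es.map fun e => s(e.1, e.2)).Nodup ∧
  ∀ e : Sym2 (Fin n), e ∈ es.map (fun e => s(e.1, e.2)) ↔ e ∈ I.graph.edgeSet

/-- The input, as a sequence of machine words: the number of vertices, the number of edges, for
each vertex four words `0` or `1` telling which of the colours `1, 2, 3, 4` are on its list, and
for each edge its two ends (the vertices being numbered `0, …, n - 1`). -/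
def encode {n : ℕ} (I : StubbornInstance (Fin n)) (es : List (Fin n × Fin n)) : List ℕ :=
  [n, es.length] ++
  ((List.finRange n).flatMap fun v =>
    [1, 2, 3, 4].map fun k => if k ∈ I.lists v then 1 else 0) ++
  (es.flatMap fun e => [(e.1 : ℕ), (e.2 : ℕ)])

end StubbornInstance

/-! ### Random access machines

Programs over registers `R₀, R₁, …` (a program mentions only finitely many of them) and a random
access memory `M`, all cells of which hold natural numbers. Every elementary instruction and every
evaluation of a test takes one step. -/

namespace RAM

structure State where
  reg : ℕ → ℕ
  mem : ℕ → ℕ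

/-- The elementary instructions. -/
inductive Instr where
  /-- `Rᵢ := c` -/
  | const (i c : ℕ)
  /-- `Rᵢ := Rⱼ` -/
  | move (i j : ℕ)
  /-- `Rᵢ := Rⱼ + Rₖ` -/
  | add (i j k : ℕ)
  /-- `Rᵢ := max (Rⱼ - Rₖ) 0` -/
  | sub (i j k : ℕ)
  /-- `Rᵢ := Rⱼ * Rₖ` -/
  | mul (i j k : ℕ)
  /-- `Rᵢ := M[Rⱼ]` -/
  | load (i j : ℕ)
  /-- `M[Rᵢ] := Rⱼ` -/
  | store (i j : ℕ)

/-- The value that an instruction writes. -/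
def Instr.value (s : State) : Instr → ℕ
  | const _ c => c
  | move _ j => s.reg j
  | add _ j k => s.reg j + s.reg k
  | sub _ j k => s.reg j - s.reg k
  | mul _ j k => s.reg j * s.reg k
  | load _ j => s.mem (s.reg j)
  | store _ j => s.reg j

/-- The state after an instruction. -/
def Instr.next (s : State) (a : Instr) : State :=
  match a with
  | const i _ | move i _ | add i _ _ | sub i _ _ | mul i _ _ | load i _ =>
      { s with reg := Function.update s.reg i (a.value s) }
  | store i _ => { s with mem := Function.update s.mem (s.reg i) (a.value s) }

/-- The tests: `Rᵢ = Rⱼ` and `Rᵢ < Rⱼ`. -/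
inductive Test where
  | eq (i j : ℕ)
  | lt (i j : ℕ)

def Test.Holds (s : State) : Test → Prop
  | eq i j => s.reg i = s.reg j
  | lt i j => s.reg i < s.reg j

/-- Programs. -/
inductive Prog where
  | skip
  | instr (a : Instr)
  | seq (p q : Prog)
  | ite (b : Test) (p q : Prog)
  | while (b : Test) (p : Prog)

/-- `Exec B p s t s'`: the program `p`, started in the state `s` on a machine whose words hold the
numbers below `B`, halts in the state `s'` after exactly `t` steps. An instruction whose result
does not fit in a word cannot be executed. -/
inductive Exec (B : ℕ) : Prog → State → ℕ → State → Prop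
  | skip (s : State) : Exec B .skip s 1 s
  | instr (a : Instr) (s : State) (h : a.value s < B) : Exec B (.instr a) s 1 (a.next s)
  | seq {p q : Prog} {s s' s'' : State} {t t' : ℕ}
      (hp : Exec B p s t s') (hq : Exec B q s' t' s'') : Exec B (.seq p q) s (t + t') s''
  | ite_true {b : Test} {p q : Prog} {s s' : State} {t : ℕ}
      (hb : b.Holds s) (hp : Exec B p s t s') : Exec B (.ite b p q) s (t + 1) s'
  | ite_false {b : Test} {p q : Prog} {s s' : State} {t : ℕ}
      (hb : ¬ b.Holds s) (hq : Exec B q s t s') : Exec B (.ite b p q) s (t + 1) s'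
  | while_true {b : Test} {p : Prog} {s s' s'' : State} {t t' : ℕ}
      (hb : b.Holds s) (hp : Exec B p s t s') (hw : Exec B (.while b p) s' t' s'') :
      Exec B (.while b p) s (t + t' + 1) s''
  | while_false {b : Test} {p : Prog} {s : State}
      (hb : ¬ b.Holds s) : Exec B (.while b p) s 1 s

/-- The machine is deterministic: the final state and the number of steps are determined by the
program and the initial state. -/
theorem Exec.deterministic {B : ℕ} {p : Prog} {s s₁ s₂ : State} {t₁ t₂ : ℕ}
    (h₁ : Exec B p s t₁ s₁) (h₂ : Exec B p s t₂ s₂) : t₁ = t₂ ∧ s₁ = s₂ := by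
  induction h₁ generalizing t₂ s₂ with
  | skip s => cases h₂; exact ⟨rfl, rfl⟩
  | instr a s h => cases h₂; exact ⟨rfl, rfl⟩
  | seq _ _ ih ih' =>
    cases h₂ with
    | seq hp hq =>
      obtain ⟨rfl, rfl⟩ := ih hp
      obtain ⟨rfl, rfl⟩ := ih' hq
      exact ⟨rfl, rfl⟩
  | ite_true hb _ ih =>
    cases h₂ with
    | ite_true _ hp => obtain ⟨rfl, rfl⟩ := ih hp; exact ⟨rfl, rfl⟩
    | ite_false hb' _ => exact absurd hb hb'
  | ite_false hb _ ih =>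
    cases h₂ with
    | ite_true hb' _ => exact absurd hb' hb
    | ite_false _ hp => obtain ⟨rfl, rfl⟩ := ih hp; exact ⟨rfl, rfl⟩
  | while_true hb _ _ ih ih' =>
    cases h₂ with
    | while_true _ hp hw =>
      obtain ⟨rfl, rfl⟩ := ih hp
      obtain ⟨rfl, rfl⟩ := ih' hw
      exact ⟨rfl, rfl⟩
    | while_false hb' => exact absurd hb hb'
  | while_false hb =>
    cases h₂ with
    | while_true hb' _ _ => exact absurd hb' hb
    | while_false _ => exact ⟨rfl, rfl⟩

/-- The initial state on the input `w`: the word `w` stands in the cells `0, 1, …` of the memory;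
all other cells and all registers hold `0`. -/
def init (w : List ℕ) : State where
  reg := fun _ => 0
  mem := fun a => w.getD a 0

end RAM

/-! ### A language of bounded loops and its compilation -/

namespace BL

/-! The algorithm is iterative compression followed by a branching search with a small search tree.

Colour 1 may be struck from every list that contains 3. Recolouring all the affected vertices from 1
to 3 creates no conflict, because 3 conflicts only with 1, whereas 1 already conflicts with both 1
and 3 (`solvable_iff`).

The vertices are added one at a time. Let `O` be a feasible colouring of the vertices below `v`, and
suppose that there is a feasible colouring `N` of those below `v + 1`. A clique and an independent
set share at most one vertex, so at most one old vertex passes from 4 to 1, at most one from 4 to 2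
and at most one from 2 to 4. These three vertices and the colour of `v` are guessed, in O(n³) ways
(`Has.sol_of_start`). For a right guess `N` survives the removal of the excluded colours. Besides
its colour under `O`, every vertex then has alternatives in {2, 4} only, or at most one alternative
(`start_valid`).

The search keeps `O` as the current colouring. It picks a vertex whose current colour is not
admissible, branches over its admissible colours, and strikes the colours that conflict with the
choice. If no such vertex exists, the current colouring is feasible (`Valid.sol`). There are at most
two branches, and if there are two, they are 2 and 4. The branch 2 strikes 2 at the neighbours and
the branch 4 strikes 4 at the non-neighbours, so every other vertex admitting both colours stops
doing so in at least one branch (`ambig_children`). Therefore the search tree has only O(n²) nodes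
(`Valid.sum_weight`).

A node takes linear time, so the total is n · n³ · n² · n = n⁷. To count machine steps, the
algorithm is written with bounded loops only. Every variable has a static bound C * K ^ d, with K =
|G| + 2, and running times are bounds of the same form. `Cmd.simulates` proves once and for all that
compiled code obeys them; for the concrete program the bounds are then evaluated by `decide`. -/

/-- Expressions over registers and memory. -/
inductive Expr where
  | var (i : ℕ)
  | lit (c : ℕ)
  | add (a b : Expr)
  | sub (a b : Expr)
  | mul (a b : Expr)
  | ld (a : Expr)

namespace Expr

def eval (s : RAM.State) : Expr → ℕ
  | var i => s.reg i
  | lit c => c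
  | add a b => a.eval s + b.eval s
  | sub a b => a.eval s - b.eval s
  | mul a b => a.eval s * b.eval s
  | ld a => s.mem (a.eval s)

/-- Code computing an expression into the odd register number `d`, using the odd registers from
`d` on as scratch space; the variable `i` is held by the register `2 * i`. -/
def code : Expr → ℕ → RAM.Prog
  | var i, d => .instr (.move (2 * d + 1) (2 * i))
  | lit c, d => .instr (.const (2 * d + 1) c)
  | add a b, d => .seq (a.code d) (.seq (b.code (d + 1))
      (.instr (.add (2 * d + 1) (2 * d + 1) (2 * (d + 1) + 1))))
  | sub a b, d => .seq (a.code d) (.seq (b.code (d + 1))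
      (.instr (.sub (2 * d + 1) (2 * d + 1) (2 * (d + 1) + 1))))
  | mul a b, d => .seq (a.code d) (.seq (b.code (d + 1))
      (.instr (.mul (2 * d + 1) (2 * d + 1) (2 * (d + 1) + 1))))
  | ld a, d => .seq (a.code d) (.instr (.load (2 * d + 1) (2 * d + 1)))

/-- The number of steps of the code of an expression. -/
def time : Expr → ℕ
  | var _ => 1
  | lit _ => 1
  | add a b => a.time + b.time + 1
  | sub a b => a.time + b.time + 1
  | mul a b => a.time + b.time + 1
  | ld a => a.time + 1

/-- The type `(C, d)` of an expression: its value is at most `C * K ^ d`, provided that the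
variables are bounded by their types in `Γ` and the memory cells by `5 * K`. -/
def ty (Γ : ℕ → ℕ × ℕ) : Expr → ℕ × ℕ
  | var i => Γ i
  | lit c => (c, 0)
  | add a b => ((a.ty Γ).1 + (b.ty Γ).1, max (a.ty Γ).2 (b.ty Γ).2)
  | sub a _ => a.ty Γ
  | mul a b => ((a.ty Γ).1 * (b.ty Γ).1, (a.ty Γ).2 + (b.ty Γ).2)
  | ld _ => (5, 1)

def small (t : ℕ × ℕ) : Bool := decide (t.1 ≤ 2 ^ 20) && decide (t.2 ≤ 19)

/-- All subexpressions have small types. -/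
def check (Γ : ℕ → ℕ × ℕ) : Expr → Bool
  | var i => small (Γ i)
  | lit c => small (c, 0)
  | add a b => a.check Γ && b.check Γ && small ((add a b).ty Γ)
  | sub a b => a.check Γ && b.check Γ
  | mul a b => a.check Γ && b.check Γ && small ((mul a b).ty Γ)
  | ld a => a.check Γ

end Expr

/-- `s` holds the variables and the memory of `σ`. -/
def Rel (s σ : RAM.State) : Prop :=
  (∀ i, s.reg (2 * i) = σ.reg i) ∧ s.mem = σ.mem

/-! ### Bounds C * K ^ d and the word size -/

def bd (K : ℕ) (t : ℕ × ℕ) : ℕ := t.1 * K ^ t.2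

/-- The state is bounded by the types of the variables. -/
def WT (K : ℕ) (Γ : ℕ → ℕ × ℕ) (σ : RAM.State) : Prop :=
  (∀ i, σ.reg i ≤ bd K (Γ i)) ∧ ∀ a, σ.mem a ≤ bd K (5, 1)

/-- As 2 ≤ K, the constant 2 ^ 20 is absorbed by K ^ 20. The thresholds in `Expr.small` thus give K
^ 39 at most, which is the origin of the word size K ^ 40. -/
theorem bd_lt_of_small {K : ℕ} (hK : 2 ≤ K) {t : ℕ × ℕ} (h : Expr.small t = true) :
    bd K t < K ^ 40 := by
  simp only [Expr.small, Bool.and_eq_true, decide_eq_true_eq] at h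
  calc bd K t ≤ 2 ^ 20 * K ^ 19 := Nat.mul_le_mul h.1 (Nat.pow_le_pow_right (by omega) h.2)
    _ ≤ K ^ 20 * K ^ 19 := Nat.mul_le_mul_right _ (Nat.pow_le_pow_left hK _)
    _ = K ^ 39 := by rw [← pow_add]
    _ < K ^ 40 := Nat.pow_lt_pow_right (by omega) (by norm_num)

theorem bd_add_le {K : ℕ} (hK : 1 ≤ K) (s t : ℕ × ℕ) :
    bd K s + bd K t ≤ bd K (s.1 + t.1, max s.2 t.2) := by
  unfold bd
  rw [Nat.add_mul]
  exact Nat.add_le_add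
    (Nat.mul_le_mul_left _ (Nat.pow_le_pow_right hK (le_max_left _ _)))
    (Nat.mul_le_mul_left _ (Nat.pow_le_pow_right hK (le_max_right _ _)))

theorem bd_mul (K : ℕ) (s t : ℕ × ℕ) : bd K s * bd K t = bd K (s.1 * t.1, s.2 + t.2) := by
  unfold bd; rw [pow_add]; ring

theorem bd_mono {K : ℕ} (hK : 1 ≤ K) {s t : ℕ × ℕ} (h₁ : s.1 ≤ t.1) (h₂ : s.2 ≤ t.2) :
    bd K s ≤ bd K t :=
  Nat.mul_le_mul h₁ (Nat.pow_le_pow_right hK h₂)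

theorem Expr.eval_le {K : ℕ} (hK : 1 ≤ K) {Γ : ℕ → ℕ × ℕ} {σ : RAM.State} (hσ : WT K Γ σ) :
    ∀ e : Expr, e.eval σ ≤ bd K (e.ty Γ)
  | var i => hσ.1 i
  | lit c => by simp [eval, ty, bd]
  | add a b => (Nat.add_le_add (a.eval_le hK hσ) (b.eval_le hK hσ)).trans (bd_add_le hK _ _)
  | sub a _ => (Nat.sub_le _ _).trans (a.eval_le hK hσ)
  | mul a b => (Nat.mul_le_mul (a.eval_le hK hσ) (b.eval_le hK hσ)).trans (bd_mul K _ _).le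
  | ld a => hσ.2 _

/-- A difference is bounded by its first operand and a loaded value by the memory bound, so `check`
tests sizes only at variables, literals, sums and products. -/
theorem Expr.eval_lt {K : ℕ} (hK : 2 ≤ K) {Γ : ℕ → ℕ × ℕ} {σ : RAM.State} (hσ : WT K Γ σ)
    (e : Expr) (he : e.check Γ = true) : e.eval σ < K ^ 40 := by
  have hK1 : 1 ≤ K := by omega
  induction e with
  | var i => exact (hσ.1 i).trans_lt (bd_lt_of_small hK he)
  | lit c => simpa [bd, eval] using bd_lt_of_small hK he
  | add a b _ _ =>
    simp only [check, Bool.and_eq_true] at he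
    exact ((add a b).eval_le hK1 hσ).trans_lt (bd_lt_of_small hK he.2)
  | mul a b _ _ =>
    simp only [check, Bool.and_eq_true] at he
    exact ((mul a b).eval_le hK1 hσ).trans_lt (bd_lt_of_small hK he.2)
  | sub a b iha _ =>
    simp only [check, Bool.and_eq_true] at he
    exact (Nat.sub_le _ _).trans_lt (iha he.1)
  | ld a _ => exact (hσ.2 _).trans_lt (bd_lt_of_small hK rfl)

/-! ### Code for expressions: variables in even registers, scratch space in odd ones -/

theorem Rel.update_temp {s σ : RAM.State} (h : Rel s σ) (d x : ℕ) :
    Rel { s with reg := Function.update s.reg (2 * d + 1) x } σ := by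
  refine ⟨fun i => ?_, h.2⟩
  rw [← h.1 i]
  exact Function.update_of_ne (by omega) _ _

theorem Rel.update_var {s σ : RAM.State} (h : Rel s σ) (i x : ℕ) :
    Rel { s with reg := Function.update s.reg (2 * i) x }
      { σ with reg := Function.update σ.reg i x } := by
  refine ⟨fun j => ?_, h.2⟩
  by_cases hj : j = i
  · subst hj; simp
  · simp only
    rw [Function.update_of_ne (by omega), Function.update_of_ne hj, h.1]

/-- The outcome of code for an expression. -/
def Computes (B : ℕ) (p : RAM.Prog) (s : RAM.State) (t d x : ℕ) : Prop :=
  ∃ s', RAM.Exec B p s t s' ∧ (∀ σ, Rel s σ → Rel s' σ) ∧ s'.reg (2 * d + 1) = x ∧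
    ∀ j < d, s'.reg (2 * j + 1) = s.reg (2 * j + 1)

/-- The left value waits in scratch register `d` while the right operand is computed from `d + 1`
on, which leaves the lower scratch registers alone. The hypothesis on `q` ranges over all `s₁`
because of the state after `p` only the represented variables and memory matter. -/
theorem Computes.binary {B : ℕ} {p q : RAM.Prog} {s : RAM.State} {t t' d x y : ℕ}
    (hp : Computes B p s t d x)
    (hq : ∀ s₁, (∀ σ, Rel s σ → Rel s₁ σ) → Computes B q s₁ t' (d + 1) y)
    (f : ℕ → ℕ → ℕ) (a : RAM.Instr)
    (ha : ∀ s, a.value s = f (s.reg (2 * d + 1)) (s.reg (2 * (d + 1) + 1)))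
    (ha' : ∀ s, a.next s = { s with reg := Function.update s.reg (2 * d + 1) (a.value s) })
    (hB : f x y < B) :
    Computes B (.seq p (.seq q (.instr a))) s (t + t' + 1) d (f x y) := by
  obtain ⟨s₁, he, hr, hx, hf⟩ := hp
  obtain ⟨s₂, he', hr', hy, hf'⟩ := hq s₁ hr
  have hv : a.value s₂ = f x y := by rw [ha, hf' d (by omega), hx, hy]
  refine ⟨a.next s₂, ?_, ?_, ?_, ?_⟩
  · rw [Nat.add_assoc]
    exact .seq he (.seq he' (.instr a s₂ (by rw [hv]; exact hB)))
  · intro σ h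
    rw [ha']
    exact (hr' σ (hr σ h)).update_temp _ _
  · rw [ha', hv]; simp
  · intro j hj
    rw [ha']
    simp only
    rw [Function.update_of_ne (by omega), hf' j (by omega), hf j hj]

theorem Expr.computes {K : ℕ} (hK : 2 ≤ K) {Γ : ℕ → ℕ × ℕ} {σ : RAM.State} (hσ : WT K Γ σ)
    (e : Expr) (hc : e.check Γ = true) (s : RAM.State) (hs : Rel s σ) (d : ℕ) :
    Computes (K ^ 40) (e.code d) s e.time d (e.eval σ) := by
  have hK1 : 1 ≤ K := by omega
  induction e generalizing s d with
  | var i =>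
    refine ⟨_, .instr _ _ ?_, fun σ h => h.update_temp _ _, ?_, ?_⟩
    · simp only [RAM.Instr.value, hs.1 i]
      exact (hσ.1 i).trans_lt (bd_lt_of_small hK hc)
    · simp [RAM.Instr.next, RAM.Instr.value, hs.1 i, eval]
    · intro j hj
      simp only [RAM.Instr.next]
      exact Function.update_of_ne (by omega) _ _
  | lit c =>
    refine ⟨_, .instr _ _ ?_, fun σ h => h.update_temp _ _, ?_, ?_⟩
    · have := bd_lt_of_small hK hc
      simpa [RAM.Instr.value, bd] using this
    · simp [RAM.Instr.next, RAM.Instr.value, eval]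
    · intro j hj
      simp only [RAM.Instr.next]
      exact Function.update_of_ne (by omega) _ _
  | add a b iha ihb =>
    simp only [check, Bool.and_eq_true] at hc
    exact (iha hc.1.1 s hs d).binary (fun s₁ h => ihb hc.1.2 s₁ (h σ hs) (d + 1)) (· + ·) _
      (fun _ => rfl) (fun _ => rfl)
      (((add a b).eval_le hK1 hσ).trans_lt (bd_lt_of_small hK hc.2))
  | sub a b iha ihb =>
    simp only [check, Bool.and_eq_true] at hc
    exact (iha hc.1 s hs d).binary (fun s₁ h => ihb hc.2 s₁ (h σ hs) (d + 1)) (· - ·) _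
      (fun _ => rfl) (fun _ => rfl)
      ((Nat.sub_le _ _).trans_lt (a.eval_lt hK hσ hc.1))
  | mul a b iha ihb =>
    simp only [check, Bool.and_eq_true] at hc
    exact (iha hc.1.1 s hs d).binary (fun s₁ h => ihb hc.1.2 s₁ (h σ hs) (d + 1)) (· * ·) _
      (fun _ => rfl) (fun _ => rfl)
      (((mul a b).eval_le hK1 hσ).trans_lt (bd_lt_of_small hK hc.2))
  | ld a iha =>
    obtain ⟨s₁, he, hr, hx, hf⟩ := iha hc s hs d
    have hv : (RAM.Instr.load (2 * d + 1) (2 * d + 1)).value s₁ = σ.mem (a.eval σ) := by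
      simp only [RAM.Instr.value, hx, (hr σ hs).2]
    refine ⟨_, .seq he (.instr _ _ ?_), fun σ h => (hr σ h).update_temp _ _, ?_, ?_⟩
    · rw [hv]; exact (hσ.2 _).trans_lt (bd_lt_of_small hK rfl)
    · simp only [RAM.Instr.next]; rw [hv]; simp [eval]
    · intro j hj
      simp only [RAM.Instr.next]
      rw [Function.update_of_ne (by omega), hf j hj]

/-- Commands. The loop `for_ x e p` evaluates `e` once and executes `p` for `x = 0, …, e - 1`. -/
inductive Cmd where
  | skip
  | set (x : ℕ) (e : Expr)
  | sto (a e : Expr)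
  | seq (p q : Cmd)
  | ifeq (a b : Expr) (p q : Cmd)
  | iflt (a b : Expr) (p q : Cmd)
  | for_ (x : ℕ) (e : Expr) (p : Cmd)

def setR (σ : RAM.State) (x v : ℕ) : RAM.State := { σ with reg := Function.update σ.reg x v }

def setM (σ : RAM.State) (a v : ℕ) : RAM.State := { σ with mem := Function.update σ.mem a v }

theorem setR_self (σ : RAM.State) (x v : ℕ) : (setR σ x v).reg x = v :=
  Function.update_self _ _ _

theorem setR_ne (σ : RAM.State) {x y : ℕ} (v : ℕ) (h : y ≠ x) : (setR σ x v).reg y = σ.reg y :=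
  Function.update_of_ne h _ _

/-- The first `i` rounds of a loop with counter `x`. -/
def iter (f : RAM.State → RAM.State) (x : ℕ) : ℕ → RAM.State → RAM.State
  | 0, σ => σ
  | i + 1, σ => f (setR (iter f x i σ) x i)

namespace Cmd

def run : Cmd → RAM.State → RAM.State
  | skip, σ => σ
  | set x e, σ => setR σ x (e.eval σ)
  | sto a e, σ => setM σ (a.eval σ) (e.eval σ)
  | seq p q, σ => q.run (p.run σ)
  | ifeq a b p q, σ => if a.eval σ = b.eval σ then p.run σ else q.run σ
  | iflt a b p q, σ => if a.eval σ < b.eval σ then p.run σ else q.run σ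
  | for_ x e p, σ => iter p.run x (e.eval σ) σ

theorem run_seq (p q : Cmd) (σ : RAM.State) : (seq p q).run σ = q.run (p.run σ) := rfl

theorem run_ifeq_pos {a b : Expr} {σ : RAM.State} (h : a.eval σ = b.eval σ) (p q : Cmd) :
    (ifeq a b p q).run σ = p.run σ := if_pos h

theorem run_ifeq_neg {a b : Expr} {σ : RAM.State} (h : a.eval σ ≠ b.eval σ) (p q : Cmd) :
    (ifeq a b p q).run σ = q.run σ := if_neg h

theorem run_iflt_pos {a b : Expr} {σ : RAM.State} (h : a.eval σ < b.eval σ) (p q : Cmd) :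
    (iflt a b p q).run σ = p.run σ := if_pos h

theorem run_iflt_neg {a b : Expr} {σ : RAM.State} (h : ¬ a.eval σ < b.eval σ) (p q : Cmd) :
    (iflt a b p q).run σ = q.run σ := if_neg h

def code : Cmd → ℕ → RAM.Prog
  | skip, _ => .skip
  | set x e, d => .seq (e.code d) (.instr (.move (2 * x) (2 * d + 1)))
  | sto a e, d => .seq (a.code d) (.seq (e.code (d + 1))
      (.instr (.store (2 * d + 1) (2 * (d + 1) + 1))))
  | seq p q, d => .seq (p.code d) (q.code d)
  | ifeq a b p q, d => .seq (a.code d) (.seq (b.code (d + 1))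
      (.ite (.eq (2 * d + 1) (2 * (d + 1) + 1)) (p.code d) (q.code d)))
  | iflt a b p q, d => .seq (a.code d) (.seq (b.code (d + 1))
      (.ite (.lt (2 * d + 1) (2 * (d + 1) + 1)) (p.code d) (q.code d)))
  | for_ x e p, d => .seq (e.code d) (.seq (.instr (.const (2 * (d + 1) + 1) 0))
      (.while (.lt (2 * (d + 1) + 1) (2 * d + 1))
        (.seq (.instr (.move (2 * x) (2 * (d + 1) + 1)))
          (.seq (p.code (d + 2)) (.seq (.instr (.const (2 * (d + 2) + 1) 1))
            (.instr (.add (2 * (d + 1) + 1) (2 * (d + 1) + 1) (2 * (d + 2) + 1))))))))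

/-- A bound on the number of steps, in the form of a type. -/
def cost (Γ : ℕ → ℕ × ℕ) : Cmd → ℕ × ℕ
  | skip => (1, 0)
  | set _ e => (e.time + 1, 0)
  | sto a e => (a.time + e.time + 1, 0)
  | seq p q => ((p.cost Γ).1 + (q.cost Γ).1, max (p.cost Γ).2 (q.cost Γ).2)
  | ifeq a b p q => (a.time + b.time + 1 + ((p.cost Γ).1 + (q.cost Γ).1),
      max (p.cost Γ).2 (q.cost Γ).2)
  | iflt a b p q => (a.time + b.time + 1 + ((p.cost Γ).1 + (q.cost Γ).1),
      max (p.cost Γ).2 (q.cost Γ).2)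
  | for_ _ e p => ((e.ty Γ).1 * ((p.cost Γ).1 + 4) + (e.time + 2), (e.ty Γ).2 + (p.cost Γ).2)

def le (s t : ℕ × ℕ) : Bool := decide (s.1 ≤ t.1) && decide (s.2 ≤ t.2)

/-- All values that are written are bounded by their types. -/
def check (Γ : ℕ → ℕ × ℕ) : Cmd → Bool
  | skip => true
  | set x e => e.check Γ && le (e.ty Γ) (Γ x)
  | sto a e => a.check Γ && e.check Γ && le (e.ty Γ) (5, 1)
  | seq p q => p.check Γ && q.check Γ
  | ifeq a b p q => a.check Γ && b.check Γ && p.check Γ && q.check Γ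
  | iflt a b p q => a.check Γ && b.check Γ && p.check Γ && q.check Γ
  | for_ x e p => e.check Γ && le (e.ty Γ) (Γ x) && Expr.small (e.ty Γ) && p.check Γ

end Cmd

/-! ### Correctness and cost of compiled commands -/

theorem WT.setR {K : ℕ} {Γ : ℕ → ℕ × ℕ} {σ : RAM.State} (h : WT K Γ σ) {x v : ℕ}
    (hv : v ≤ bd K (Γ x)) : WT K Γ (setR σ x v) := by
  refine ⟨fun i => ?_, h.2⟩
  by_cases hi : i = x
  · subst hi; simpa [BL.setR] using hv
  · simpa [BL.setR, Function.update_of_ne hi] using h.1 i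

theorem WT.setM {K : ℕ} {Γ : ℕ → ℕ × ℕ} {σ : RAM.State} (h : WT K Γ σ) {a v : ℕ}
    (hv : v ≤ bd K (5, 1)) : WT K Γ (setM σ a v) := by
  refine ⟨h.1, fun i => ?_⟩
  by_cases hi : i = a
  · subst hi; simpa [BL.setM] using hv
  · simpa [BL.setM, Function.update_of_ne hi] using h.2 i

/-- The program `p` simulates the passage from `σ` to `σ'` in at most `T` steps. -/
def Simulates (B : ℕ) (p : RAM.Prog) (s : RAM.State) (T d : ℕ) (σ' : RAM.State) : Prop :=
  ∃ t s', RAM.Exec B p s t s' ∧ t ≤ T ∧ Rel s' σ' ∧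
    ∀ j < d, s'.reg (2 * j + 1) = s.reg (2 * j + 1)

theorem le_bd {K : ℕ} (hK : 1 ≤ K) (C d : ℕ) : C ≤ bd K (C, d) :=
  Nat.le_mul_of_pos_right _ (Nat.pow_pos hK)

/-- The bound sits in scratch register `d` and the counter in `d + 1`, while the body works from `d
+ 2` on and can damage neither. The variable `x` is reloaded from the counter in every round.
Besides the body, a round takes 4 steps: test, move, constant, addition. The final `+ 1` is the
failing test; `k` counts the remaining rounds. -/
theorem Simulates.while_counter {B b x d T : ℕ} {p : RAM.Prog} {f : RAM.State → RAM.State}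
    {Good : RAM.State → Prop} (hB : b < B) (h1 : 1 < B)
    (hp : ∀ s σ, Good σ → Rel s σ → Simulates B p s T (d + 2) (f σ))
    (hg : ∀ i σ, i < b → Good σ → Good (setR σ x i))
    (hf : ∀ σ, Good σ → Good (f σ)) {σ : RAM.State} (k i : ℕ) (hik : i + k = b)
    (s : RAM.State) (hs : Rel s (iter f x i σ)) (hgi : Good (iter f x i σ))
    (hb : s.reg (2 * d + 1) = b) (hi : s.reg (2 * (d + 1) + 1) = i) :
    Simulates B (.while (.lt (2 * (d + 1) + 1) (2 * d + 1))
        (.seq (.instr (.move (2 * x) (2 * (d + 1) + 1)))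
          (.seq p (.seq (.instr (.const (2 * (d + 2) + 1) 1))
            (.instr (.add (2 * (d + 1) + 1) (2 * (d + 1) + 1) (2 * (d + 2) + 1)))))))
      s (k * (T + 4) + 1) d (iter f x b σ) := by
  induction k generalizing i s with
  | zero =>
    obtain rfl : i = b := by omega
    exact ⟨1, s, .while_false (by simp [RAM.Test.Holds, hb, hi]), by omega, hs, fun _ _ => rfl⟩
  | succ k ih =>
    have hib : i < b := by omega
    set s₁ := (RAM.Instr.move (2 * x) (2 * (d + 1) + 1)).next s with hs₁
    have hr₁ : Rel s₁ (setR (iter f x i σ) x i) := by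
      have := hs.update_var x i
      rw [hs₁]
      simp only [RAM.Instr.next, RAM.Instr.value, hi]
      exact this
    have ho₁ : ∀ j, s₁.reg (2 * j + 1) = s.reg (2 * j + 1) := fun j =>
      Function.update_of_ne (by omega) _ _
    have hg₁ := hg i _ hib hgi
    obtain ⟨t, s₂, he, ht, hr₂, ho₂⟩ := hp s₁ _ hg₁ hr₁
    set s₃ := (RAM.Instr.const (2 * (d + 2) + 1) 1).next s₂ with hs₃
    set a := RAM.Instr.add (2 * (d + 1) + 1) (2 * (d + 1) + 1) (2 * (d + 2) + 1) with ha
    have ho₃ : ∀ j < d + 2, s₃.reg (2 * j + 1) = s.reg (2 * j + 1) := fun j hj => by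
      rw [← ho₁, ← ho₂ j hj]
      exact Function.update_of_ne (by omega) _ _
    have hv : a.value s₃ = i + 1 := by
      have : s₃.reg (2 * (d + 2) + 1) = 1 := Function.update_self _ _ _
      simp only [ha, RAM.Instr.value, this, ho₃ (d + 1) (by omega), hi]
    set s₄ := a.next s₃ with hs₄
    have hr₄ : Rel s₄ (iter f x (i + 1) σ) := (hr₂.update_temp _ _).update_temp _ _
    have ho₄ : ∀ j < d + 1, s₄.reg (2 * j + 1) = s.reg (2 * j + 1) := fun j hj => by
      rw [← ho₃ j (by omega)]
      exact Function.update_of_ne (by omega) _ _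
    have hi₄ : s₄.reg (2 * (d + 1) + 1) = i + 1 := by
      rw [hs₄]; simp only [ha, RAM.Instr.next]; rw [← ha, hv]; simp
    obtain ⟨t', s₅, he', ht', hr₅, ho₅⟩ := ih (i + 1) (by omega) s₄ hr₄ (hf _ hg₁)
      (by rw [ho₄ d (by omega), hb]) hi₄
    refine ⟨_, s₅, .while_true (by simp [RAM.Test.Holds, hb, hi, hib])
      (.seq (.instr _ _ ?_) (.seq he (.seq (.instr _ _ ?_) (.instr _ _ ?_)))) he', ?_, hr₅, ?_⟩
    · simp only [RAM.Instr.value, hi]; omega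
    · simpa [RAM.Instr.value] using h1
    · rw [← hs₃, hv]; omega
    · rw [Nat.add_mul]; omega
    · intro j hj; rw [ho₅ j hj, ho₄ j (by omega)]

/-- Both branches are charged, which keeps the bound a single type. -/
theorem Simulates.branch {K B : ℕ} (hK : 1 ≤ K) {p₁ p₂ p q : RAM.Prog} {s s₁ s₂ : RAM.State}
    {t₁ t₂ d : ℕ} {T T' : ℕ × ℕ} {b : RAM.Test} {P : Prop} [Decidable P] {σ₁ σ₂ : RAM.State}
    (h₁ : RAM.Exec B p₁ s t₁ s₁) (h₂ : RAM.Exec B p₂ s₁ t₂ s₂)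
    (hf : ∀ j < d, s₂.reg (2 * j + 1) = s.reg (2 * j + 1)) (hb : b.Holds s₂ ↔ P)
    (hp : P → Simulates B p s₂ (bd K T) d σ₁) (hq : ¬ P → Simulates B q s₂ (bd K T') d σ₂) :
    Simulates B (.seq p₁ (.seq p₂ (.ite b p q))) s
      (bd K (t₁ + t₂ + 1 + (T.1 + T'.1), max T.2 T'.2)) d (if P then σ₁ else σ₂) := by
  have hle : t₁ + t₂ + 1 + (bd K T + bd K T') ≤
      bd K (t₁ + t₂ + 1 + (T.1 + T'.1), max T.2 T'.2) := by
    refine (Nat.add_le_add_left (bd_add_le hK T T') _).trans ?_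
    refine (Nat.add_le_add_right (le_bd hK _ 0) _).trans ((bd_add_le hK _ _).trans ?_)
    exact bd_mono hK le_rfl (by simp)
  split_ifs with h
  · obtain ⟨t, s', he, ht, hr, ho⟩ := hp h
    exact ⟨_, s', .seq h₁ (.seq h₂ (.ite_true (hb.2 h) he)), by omega, hr,
      fun j hj => (ho j hj).trans (hf j hj)⟩
  · obtain ⟨t, s', he, ht, hr, ho⟩ := hq h
    exact ⟨_, s', .seq h₁ (.seq h₂ (.ite_false (fun h' => h (hb.1 h')) he)), by omega, hr,
      fun j hj => (ho j hj).trans (hf j hj)⟩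

/-- Every assignment is checked separately against the fixed bounds in `Γ`, so these survive any
number of rounds of a loop. -/
theorem Cmd.run_wt {K : ℕ} (hK : 2 ≤ K) {Γ : ℕ → ℕ × ℕ} (c : Cmd) (hc : c.check Γ = true)
    {σ : RAM.State} (hσ : WT K Γ σ) : WT K Γ (c.run σ) := by
  have hK1 : 1 ≤ K := by omega
  induction c generalizing σ with
  | skip => exact hσ
  | set x e =>
    simp only [check, le, Bool.and_eq_true, decide_eq_true_eq] at hc
    exact hσ.setR ((e.eval_le hK1 hσ).trans (bd_mono hK1 hc.2.1 hc.2.2))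
  | sto a e =>
    simp only [check, le, Bool.and_eq_true, decide_eq_true_eq] at hc
    exact hσ.setM ((e.eval_le hK1 hσ).trans (bd_mono hK1 hc.2.1 hc.2.2))
  | seq p q ihp ihq =>
    simp only [check, Bool.and_eq_true] at hc
    exact ihq hc.2 (ihp hc.1 hσ)
  | ifeq a b p q ihp ihq =>
    simp only [check, Bool.and_eq_true] at hc
    simp only [run]
    split_ifs
    exacts [ihp hc.1.2 hσ, ihq hc.2 hσ]
  | iflt a b p q ihp ihq =>
    simp only [check, Bool.and_eq_true] at hc
    simp only [run]
    split_ifs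
    exacts [ihp hc.1.2 hσ, ihq hc.2 hσ]
  | for_ x e p ih =>
    simp only [check, le, Bool.and_eq_true, decide_eq_true_eq] at hc
    have hle := (e.eval_le hK1 hσ).trans (bd_mono hK1 hc.1.1.2.1 hc.1.1.2.2)
    have : ∀ i ≤ e.eval σ, WT K Γ (iter p.run x i σ) := by
      intro i
      induction i with
      | zero => exact fun _ => hσ
      | succ i ihi => exact fun hi => ih hc.2 ((ihi (by omega)).setR (by omega))
    exact this _ le_rfl

theorem Cmd.simulates {K : ℕ} (hK : 2 ≤ K) {Γ : ℕ → ℕ × ℕ} (c : Cmd) (hc : c.check Γ = true)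
    {σ : RAM.State} (hσ : WT K Γ σ) (s : RAM.State) (hs : Rel s σ) (d : ℕ) :
    Simulates (K ^ 40) (c.code d) s (bd K (c.cost Γ)) d (c.run σ) := by
  have hK1 : 1 ≤ K := by omega
  have hB1 : 1 < K ^ 40 := Nat.one_lt_pow (by norm_num) (by omega)
  induction c generalizing σ s d with
  | skip => exact ⟨1, s, .skip s, by simp [cost, bd], hs, fun _ _ => rfl⟩
  | set x e =>
    simp only [check, le, Bool.and_eq_true, decide_eq_true_eq] at hc
    obtain ⟨s₁, he, hr, hx, hf⟩ := e.computes hK hσ hc.1 s hs d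
    refine ⟨_, _, .seq he (.instr _ _ ?_), le_bd hK1 _ _, ?_, ?_⟩
    · simp only [RAM.Instr.value, hx]
      exact e.eval_lt hK hσ hc.1
    · have := (hr σ hs).update_var x (e.eval σ)
      simp only [RAM.Instr.next, RAM.Instr.value, hx]
      exact this
    · intro j hj
      rw [← hf j hj]
      exact Function.update_of_ne (by omega) _ _
  | sto a e =>
    simp only [check, le, Bool.and_eq_true, decide_eq_true_eq] at hc
    obtain ⟨s₁, he₁, hr₁, hx₁, hf₁⟩ := a.computes hK hσ hc.1.1 s hs d
    obtain ⟨s₂, he₂, hr₂, hx₂, hf₂⟩ := e.computes hK hσ hc.1.2 s₁ (hr₁ σ hs) (d + 1)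
    refine ⟨_, _, .seq he₁ (.seq he₂ (.instr _ _ ?_)), ?_, ?_, ?_⟩
    · simp only [RAM.Instr.value, hx₂]
      exact e.eval_lt hK hσ hc.1.2
    · rw [← Nat.add_assoc]; exact le_bd hK1 _ _
    · have h := hr₂ σ (hr₁ σ hs)
      refine ⟨h.1, ?_⟩
      simp only [RAM.Instr.next, RAM.Instr.value, hx₂, hf₂ d (by omega), hx₁, h.2]
      rfl
    · intro j hj
      simp only [RAM.Instr.next]
      rw [hf₂ j (by omega), hf₁ j hj]
  | seq p q ihp ihq =>
    simp only [check, Bool.and_eq_true] at hc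
    obtain ⟨t₁, s₁, he₁, ht₁, hr₁, ho₁⟩ := ihp hc.1 hσ s hs d
    obtain ⟨t₂, s₂, he₂, ht₂, hr₂, ho₂⟩ := ihq hc.2 (run_wt hK _ hc.1 hσ) s₁ hr₁ d
    exact ⟨_, s₂, .seq he₁ he₂, (Nat.add_le_add ht₁ ht₂).trans (bd_add_le hK1 _ _), hr₂,
      fun j hj => (ho₂ j hj).trans (ho₁ j hj)⟩
  | ifeq a b p q ihp ihq =>
    simp only [check, Bool.and_eq_true] at hc
    obtain ⟨s₁, he₁, hr₁, hx₁, hf₁⟩ := a.computes hK hσ hc.1.1.1 s hs d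
    obtain ⟨s₂, he₂, hr₂, hx₂, hf₂⟩ := b.computes hK hσ hc.1.1.2 s₁ (hr₁ σ hs) (d + 1)
    have hr := hr₂ σ (hr₁ σ hs)
    have hf : ∀ j < d, s₂.reg (2 * j + 1) = s.reg (2 * j + 1) := fun j hj =>
      (hf₂ j (by omega)).trans (hf₁ j hj)
    have hx : s₂.reg (2 * d + 1) = a.eval σ := by rw [hf₂ d (by omega), hx₁]
    refine Simulates.branch hK1 he₁ he₂ hf ?_ (fun h => ihp hc.1.2 hσ s₂ hr d)
      (fun h => ihq hc.2 hσ s₂ hr d)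
    simp only [RAM.Test.Holds, hx, hx₂]
  | iflt a b p q ihp ihq =>
    simp only [check, Bool.and_eq_true] at hc
    obtain ⟨s₁, he₁, hr₁, hx₁, hf₁⟩ := a.computes hK hσ hc.1.1.1 s hs d
    obtain ⟨s₂, he₂, hr₂, hx₂, hf₂⟩ := b.computes hK hσ hc.1.1.2 s₁ (hr₁ σ hs) (d + 1)
    have hr := hr₂ σ (hr₁ σ hs)
    have hf : ∀ j < d, s₂.reg (2 * j + 1) = s.reg (2 * j + 1) := fun j hj =>
      (hf₂ j (by omega)).trans (hf₁ j hj)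
    have hx : s₂.reg (2 * d + 1) = a.eval σ := by rw [hf₂ d (by omega), hx₁]
    refine Simulates.branch hK1 he₁ he₂ hf ?_ (fun h => ihp hc.1.2 hσ s₂ hr d)
      (fun h => ihq hc.2 hσ s₂ hr d)
    simp only [RAM.Test.Holds, hx, hx₂]
  | for_ x e p ih =>
    simp only [check, le, Bool.and_eq_true, decide_eq_true_eq] at hc
    have hle := (e.eval_le hK1 hσ).trans (bd_mono hK1 hc.1.1.2.1 hc.1.1.2.2)
    obtain ⟨s₁, he₁, hr₁, hx₁, hf₁⟩ := e.computes hK hσ hc.1.1.1 s hs d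
    have hx₂ : ((RAM.Instr.const (2 * (d + 1) + 1) 0).next s₁).reg (2 * d + 1) = e.eval σ := by
      rw [← hx₁]; exact Function.update_of_ne (by omega) _ _
    obtain ⟨t, s₃, he₃, ht, hr₃, hf₃⟩ := Simulates.while_counter (Good := WT K Γ) (x := x)
      (e.eval_lt hK hσ hc.1.1.1) hB1
      (fun s σ hσ hs => ih hc.2 hσ s hs (d + 2))
      (fun i σ hi hσ => hσ.setR (by omega)) (fun σ hσ => run_wt hK p hc.2 hσ)
      (e.eval σ) 0 (by omega) ((RAM.Instr.const (2 * (d + 1) + 1) 0).next s₁)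
      ((hr₁ σ hs).update_temp _ _) hσ hx₂ (Function.update_self _ _ _)
    refine ⟨_, s₃, .seq he₁ (.seq (.instr _ _ ?_) he₃), ?_, hr₃, ?_⟩
    · simp only [RAM.Instr.value]; omega
    -- As 1 ≤ K, the 4 extra steps per round can be added to the leading constant of the cost of the
    -- body.
    · have h₁ : e.eval σ * (bd K (p.cost Γ) + 4) ≤
          bd K ((e.ty Γ).1 * ((p.cost Γ).1 + 4), (e.ty Γ).2 + (p.cost Γ).2) := by
        rw [← bd_mul K (e.ty Γ) ((p.cost Γ).1 + 4, (p.cost Γ).2)]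
        refine Nat.mul_le_mul (e.eval_le hK1 hσ) ?_
        exact (Nat.add_le_add_left (le_bd hK1 4 0) _).trans
          ((bd_add_le hK1 _ _).trans (bd_mono hK1 le_rfl (by simp)))
      have h₂ := (Nat.add_le_add h₁ (le_bd hK1 (e.time + 2) 0)).trans (bd_add_le hK1 _ _)
      simp only [Nat.max_zero] at h₂
      simp only [cost]
      omega
    · intro j hj
      rw [hf₃ j hj, ← hf₁ j hj]
      exact Function.update_of_ne (by omega) _ _

/-! ### What a command leaves unchanged, and invariants of loops -/

namespace Cmd

/-- The variables that a command may change. -/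
def mods : Cmd → List ℕ
  | skip => []
  | set x _ => [x]
  | sto _ _ => []
  | seq p q => p.mods ++ q.mods
  | ifeq _ _ p q => p.mods ++ q.mods
  | iflt _ _ p q => p.mods ++ q.mods
  | for_ x _ p => x :: p.mods

theorem run_reg (c : Cmd) (σ : RAM.State) {y : ℕ} (hy : y ∉ c.mods) :
    (c.run σ).reg y = σ.reg y := by
  induction c generalizing σ with
  | skip => rfl
  | set x e => exact Function.update_of_ne (by simpa [mods] using hy) _ _
  | sto a e => rfl
  | seq p q ihp ihq =>
    simp only [mods, List.mem_append, not_or] at hy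
    exact (ihq _ hy.2).trans (ihp _ hy.1)
  | ifeq a b p q ihp ihq =>
    simp only [mods, List.mem_append, not_or] at hy
    simp only [run]
    split_ifs
    exacts [ihp _ hy.1, ihq _ hy.2]
  | iflt a b p q ihp ihq =>
    simp only [mods, List.mem_append, not_or] at hy
    simp only [run]
    split_ifs
    exacts [ihp _ hy.1, ihq _ hy.2]
  | for_ x e p ih =>
    simp only [mods, List.mem_cons, not_or] at hy
    have : ∀ i, (iter p.run x i σ).reg y = σ.reg y := by
      intro i
      induction i with
      | zero => rfl
      | succ i ihi =>
        rw [← ihi]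
        exact (ih _ hy.2).trans (Function.update_of_ne hy.1 _ _)
    exact this _

/-- A command without stores. -/
def pure : Cmd → Bool
  | skip => true
  | set _ _ => true
  | sto _ _ => false
  | seq p q => p.pure && q.pure
  | ifeq _ _ p q => p.pure && q.pure
  | iflt _ _ p q => p.pure && q.pure
  | for_ _ _ p => p.pure

theorem run_mem (c : Cmd) (σ : RAM.State) (hc : c.pure = true) : (c.run σ).mem = σ.mem := by
  induction c generalizing σ with
  | skip => rfl
  | set x e => rfl
  | sto a e => cases hc
  | seq p q ihp ihq =>
    simp only [pure, Bool.and_eq_true] at hc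
    exact (ihq _ hc.2).trans (ihp _ hc.1)
  | ifeq a b p q ihp ihq =>
    simp only [pure, Bool.and_eq_true] at hc
    simp only [run]
    split_ifs
    exacts [ihp _ hc.1, ihq _ hc.2]
  | iflt a b p q ihp ihq =>
    simp only [pure, Bool.and_eq_true] at hc
    simp only [run]
    split_ifs
    exacts [ihp _ hc.1, ihq _ hc.2]
  | for_ x e p ih =>
    have : ∀ i, (iter p.run x i σ).mem = σ.mem := by
      intro i
      induction i with
      | zero => rfl
      | succ i ihi => rw [← ihi]; exact ih _ hc
    exact this _

/-- The invariant rule. -/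
theorem run_for {x : ℕ} {e : Expr} {p : Cmd} {σ : RAM.State} (Inv : ℕ → RAM.State → Prop)
    (h0 : Inv 0 σ)
    (hs : ∀ i τ, i < e.eval σ → (∀ y, y ∉ (for_ x e p).mods → τ.reg y = σ.reg y) →
      Inv i τ → Inv (i + 1) (p.run (setR τ x i))) :
    Inv (e.eval σ) ((for_ x e p).run σ) := by
  have : ∀ i ≤ e.eval σ, Inv i (iter p.run x i σ) ∧
      ∀ y, y ∉ (for_ x e p).mods → (iter p.run x i σ).reg y = σ.reg y := by
    intro i
    induction i with
    | zero => exact fun _ => ⟨h0, fun _ _ => rfl⟩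
    | succ i ih =>
      intro hi
      obtain ⟨h₁, h₂⟩ := ih (by omega)
      refine ⟨hs i _ hi h₂ h₁, fun y hy => ?_⟩
      rw [← h₂ y hy]
      simp only [mods, List.mem_cons, not_or] at hy
      exact (run_reg p _ hy.2).trans (Function.update_of_ne hy.1 _ _)
  exact (this _ le_rfl).1

end Cmd

end BL

/-! ### The search for a colouring, given a colouring of all vertices but one -/

namespace Stub

/-- Colours `c` and `d` must not occur together on two vertices that are adjacent (`a = 1`) or
distinct and not adjacent (`a ≠ 1`). -/
def Conf (a c d : ℕ) : Prop :=
  (a = 1 ∧ (c = 1 ∧ (d = 1 ∨ d = 3) ∨ c = 2 ∧ d = 2 ∨ c = 3 ∧ d = 1)) ∨ (a ≠ 1 ∧ c = 4 ∧ d = 4)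

instance (a c d : ℕ) : Decidable (Conf a c d) := by unfold Conf; infer_instance

theorem Conf.symm {a c d : ℕ} (h : Conf a c d) : Conf a d c := by
  unfold Conf at *; omega

/-- `N` is a feasible colouring of the vertices below `k`. -/
def Sol (A L : ℕ → ℕ → ℕ) (k : ℕ) (N : ℕ → ℕ) : Prop :=
  (∀ u < k, 1 ≤ N u ∧ N u ≤ 4 ∧ L u (N u) = 1) ∧
  ∀ u < k, ∀ w < k, u ≠ w → ¬ Conf (A u w) (N u) (N w)

/-- A state of the search: row `w` holds the current colour of the vertex `w` in column `0` and
tells in the columns `1, 2, 3, 4` which colours are still admissible. -/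
structure Valid (A L : ℕ → ℕ → ℕ) (k : ℕ) (X : ℕ → ℕ → ℕ) : Prop where
  bit : ∀ w < k, ∀ j, 1 ≤ j → j ≤ 4 → X w j = 0 ∨ X w j = 1 ∧ L w j = 1
  cur : ∀ w < k, X w 0 ≤ 4
  pair : ∀ u < k, ∀ w < k, u ≠ w →
    X u (X u 0) = 0 ∨ X w (X w 0) = 0 ∨ ¬ Conf (A u w) (X u 0) (X w 0)
  shape : ∀ w < k,
    (∀ j, 1 ≤ j → j ≤ 4 → X w j = 1 → j ≠ X w 0 → j = 2 ∨ j = 4) ∨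
    ∀ i j, 1 ≤ i → i ≤ 4 → 1 ≤ j → j ≤ 4 → X w i = 1 → X w j = 1 →
      i ≠ X w 0 → j ≠ X w 0 → i = j

/-- Some feasible colouring uses admissible colours only. -/
def Has (A L : ℕ → ℕ → ℕ) (k : ℕ) (X : ℕ → ℕ → ℕ) : Prop :=
  ∃ N, Sol A L k N ∧ ∀ w < k, X w (N w) = 1

/-- The state after the vertex `u` has received the colour `c`. -/
def child (A : ℕ → ℕ → ℕ) (u c : ℕ) (X : ℕ → ℕ → ℕ) (w j : ℕ) : ℕ :=
  if w = u then (if j = 0 then c else if j = c then 1 else 0)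
  else if j ≠ 0 ∧ Conf (A u w) c j then 0 else X w j

/-- The number of vertices that can still change their colour. -/
def loose (k : ℕ) (X : ℕ → ℕ → ℕ) : ℕ :=
  ((Finset.range k).filter fun w => ∃ j : ℕ, j < 5 ∧ j ≠ 0 ∧ X w j = 1 ∧ j ≠ X w 0).card

/-- The number of vertices that admit both of the colours `2` and `4`. -/
def ambig (k : ℕ) (X : ℕ → ℕ → ℕ) : ℕ :=
  ((Finset.range k).filter fun w => X w 2 = 1 ∧ X w 4 = 1).card

/-- Bounds the size of the search tree below `X`. A step with a single branch is paid for by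
`loose`. A step with two branches lowers the total of `ambig` and so frees n + 2 units, enough for
the second copy of `loose`, which is at most n, and the constants. -/
def weight (n k : ℕ) (X : ℕ → ℕ → ℕ) : ℕ := 1 + loose k X + (n + 2) * ambig k X

/-! ### Branching on a vertex whose current colour is not admissible -/

variable {A L : ℕ → ℕ → ℕ} {n k u c : ℕ} {X : ℕ → ℕ → ℕ}

/-- Without bad vertices only the last alternative of `pair` remains. An uncoloured vertex has `X w
0 = 0`, hence `X w (X w 0) = 0`, and so is bad automatically. -/
theorem Valid.sol (h : Valid A L k X) (hg : ∀ w < k, X w (X w 0) ≠ 0) :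
    Sol A L k fun w => X w 0 := by
  refine ⟨fun u hu => ?_, fun u hu w hw huw => ?_⟩
  · have h0 : X u 0 ≠ 0 := fun h0 => hg u hu (by rw [h0, h0])
    have h4 := h.cur u hu
    refine ⟨Nat.pos_of_ne_zero h0, h4, ?_⟩
    rcases h.bit u hu (X u 0) (Nat.pos_of_ne_zero h0) h4 with h | h
    exacts [absurd h (hg u hu), h.2]
  · rcases h.pair u hu w hw huw with h | h | h
    exacts [absurd h (hg u hu), absurd h (hg w hw), h]

theorem child_le {w j : ℕ} (hw : w ≠ u) : child A u c X w j = 0 ∨ child A u c X w j = X w j := by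
  unfold child
  rw [if_neg hw]
  split_ifs <;> simp

theorem child_zero {w : ℕ} (hw : w ≠ u) : child A u c X w 0 = X w 0 := by
  simp [child, hw]

/-- The other vertices keep their current colour even if it has just been struck: such a vertex
becomes bad instead of violating `pair`. Admissible sets only shrink, and `u` retains no alternative
to its new colour, so `shape` persists. -/
theorem Valid.child (hA : ∀ x y, A x y = A y x) (h : Valid A L k X) (hu : u < k) (hc : 1 ≤ c)
    (hc4 : c ≤ 4) (huc : X u c = 1) : Valid A L k (child A u c X) := by
  have hL : L u c = 1 := by
    rcases h.bit u hu c hc hc4 with h | h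
    exacts [absurd huc (by omega), h.2]
  have key : ∀ w < k, w ≠ u → Stub.child A u c X w (Stub.child A u c X w 0) = 0 ∨
      ¬ Conf (A u w) c (X w 0) := by
    intro w _ hw
    rw [child_zero hw]
    by_cases h0 : X w 0 = 0
    · left; rw [h0, child_zero hw, h0]
    · by_cases hcf : Conf (A u w) c (X w 0)
      · left; simp [Stub.child, hw, h0, hcf]
      · exact .inr hcf
  refine ⟨fun w hw j hj hj4 => ?_, fun w hw => ?_, fun x hx y hy hxy => ?_, fun w hw => ?_⟩
  · by_cases hwu : w = u
    · subst hwu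
      by_cases hjc : j = c
      · subst hjc; right; simp [Stub.child, hL]; omega
      · left; simp [Stub.child, hjc]; omega
    · rcases child_le (A := A) (c := c) (X := X) (j := j) hwu with h' | h'
      · exact .inl h'
      · rw [h']; exact h.bit w hw j hj hj4
  · by_cases hwu : w = u
    · subst hwu; simpa [Stub.child] using hc4
    · rw [child_zero hwu]; exact h.cur w hw
  · by_cases hxu : x = u
    · subst hxu
      rcases key y hy (Ne.symm hxy) with h' | h'
      · exact .inr (.inl h')
      · refine .inr (.inr ?_)
        rw [child_zero (Ne.symm hxy)]
        simpa [Stub.child] using h'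
    · by_cases hyu : y = u
      · subst hyu
        rcases key x hx hxy with h' | h'
        · exact .inl h'
        · refine .inr (.inr ?_)
          rw [child_zero hxy, hA]
          exact fun hcf => h' (by simpa [Stub.child] using hcf.symm)
      · rw [child_zero hxu, child_zero hyu]
        rcases h.pair x hx y hy hxy with h' | h' | h'
        · refine .inl ?_
          rcases child_le (A := A) (c := c) (X := X) (j := X x 0) hxu with h'' | h'' <;>
            simp [h'', h']
        · refine .inr (.inl ?_)
          rcases child_le (A := A) (c := c) (X := X) (j := X y 0) hyu with h'' | h'' <;>
            simp [h'', h']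
        · exact .inr (.inr h')
  · by_cases hwu : w = u
    · subst hwu
      left
      intro j hj _ h1 h2
      exfalso
      simp only [Stub.child, if_true] at h1 h2
      split_ifs at h1; omega
    · have hm : ∀ j, Stub.child A u c X w j = 1 → X w j = 1 := fun j hj => by
        rcases child_le (A := A) (c := c) (X := X) (j := j) hwu with h' | h'
        · omega
        · rw [← h', hj]
      rw [child_zero hwu]
      rcases h.shape w hw with h' | h'
      · exact .inl fun j hj hj4 h1 h2 => h' j hj hj4 (hm j h1) h2
      · exact .inr fun i j hi hi4 hj hj4 h1 h2 => h' i j hi hi4 hj hj4 (hm i h1) (hm j h2)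

/-- The branch to follow is the colour that the witness gives to `u`; being free of conflicts, the
witness loses none of its colours there. -/
theorem Has.child (h : Has A L k X) (hu : u < k) :
    ∃ c, 1 ≤ c ∧ c ≤ 4 ∧ X u c = 1 ∧ Has A L k (child A u c X) := by
  obtain ⟨N, hN, hX⟩ := h
  refine ⟨N u, (hN.1 u hu).1, (hN.1 u hu).2.1, hX u hu, N, hN, fun w hw => ?_⟩
  have h1 := (hN.1 w hw).1
  unfold Stub.child
  by_cases hwu : w = u
  · subst hwu
    rw [if_pos rfl, if_neg (by omega), if_pos rfl]
  · rw [if_neg hwu, if_neg (fun h' => hN.2 u hu w hw (Ne.symm hwu) h'.2)]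
    exact hX w hw

/-! ### The measures that bound the search tree -/

theorem child_one {w j : ℕ} (hw : w ≠ u) (h : child A u c X w j = 1) : X w j = 1 := by
  rcases child_le (A := A) (c := c) (X := X) (j := j) hw with h' | h' <;> omega

/-- The vertex `u` was loose, as `c` is admissible and its current colour is not; afterwards `c` is
both its current and its only admissible colour. No other vertex becomes loose. -/
theorem loose_child (hu : u < k) (hbad : X u (X u 0) = 0) (hc : 1 ≤ c) (hc4 : c ≤ 4)
    (huc : X u c = 1) : loose k (child A u c X) + 1 ≤ loose k X := by
  unfold loose
  refine Nat.succ_le_of_lt (Finset.card_lt_card ?_)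
  refine Finset.ssubset_iff_subset_ne.2 ⟨fun w hw => ?_, fun h => ?_⟩
  · simp only [Finset.mem_filter, Finset.mem_range] at hw ⊢
    obtain ⟨hw, j, hj, h3, h1, h2⟩ := hw
    by_cases hwu : w = u
    · subst hwu
      simp only [child, if_true] at h1 h2
      split_ifs at h1; omega
    · exact ⟨hw, j, hj, h3, child_one hwu h1, by rwa [child_zero hwu] at h2⟩
  · have : u ∈ (Finset.range k).filter fun w => ∃ j : ℕ, j < 5 ∧ j ≠ 0 ∧ X w j = 1 ∧ j ≠ X w 0 := by
      simp only [Finset.mem_filter, Finset.mem_range]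
      exact ⟨hu, c, by omega, by omega, huc, fun h => by rw [← h] at hbad; omega⟩
    rw [← h] at this
    simp only [Finset.mem_filter] at this
    obtain ⟨_, j, hj, h3, h1, h2⟩ := this
    simp only [child, if_true] at h1 h2
    split_ifs at h1; omega

theorem ambig_child : ambig k (child A u c X) ≤ ambig k X := by
  refine Finset.card_le_card fun w hw => ?_
  simp only [Finset.mem_filter] at hw ⊢
  by_cases hwu : w = u
  · subst hwu
    simp [child] at hw
    omega
  · exact ⟨hw.1, child_one hwu hw.2.1, child_one hwu hw.2.2⟩

/-- A neighbour of `u` loses 2 in the first branch and a non-neighbour loses 4 in the second. The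
two sets of vertices that remain ambiguous are therefore disjoint subsets of the old one, and both
miss `u`. -/
theorem ambig_children (hu : u < k) (h2 : X u 2 = 1) (h4 : X u 4 = 1) :
    ambig k (child A u 2 X) + ambig k (child A u 4 X) + 1 ≤ ambig k X := by
  unfold ambig
  rw [← Finset.card_union_of_disjoint]
  · refine Finset.card_lt_card (Finset.ssubset_iff_subset_ne.2 ⟨fun w hw => ?_, fun h => ?_⟩)
    · simp only [Finset.mem_union, Finset.mem_filter] at hw ⊢
      by_cases hwu : w = u
      · subst hwu; simp [child] at hw
      · rcases hw with hw | hw <;> exact ⟨hw.1, child_one hwu hw.2.1, child_one hwu hw.2.2⟩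
    · have : u ∈ (Finset.range k).filter fun w => X w 2 = 1 ∧ X w 4 = 1 := by simp [hu, h2, h4]
      rw [← h] at this
      simp [child] at this
  · rw [Finset.disjoint_left]
    intro w hw hw'
    simp only [Finset.mem_filter] at hw hw'
    by_cases hwu : w = u
    · subst hwu; simp [child] at hw
    · have h1 : ¬ Conf (A u w) 2 2 := fun h => by simp [child, hwu, h] at hw
      have h2 : ¬ Conf (A u w) 4 4 := fun h => by simp [child, hwu, h] at hw'
      unfold Conf at h1 h2; omega

theorem loose_le : loose k X ≤ k :=
  (Finset.card_filter_le _ _).trans (Finset.card_range k).le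

theorem ambig_le : ambig k X ≤ k :=
  (Finset.card_filter_le _ _).trans (Finset.card_range k).le

theorem weight_le (hk : k ≤ n) : weight n k X ≤ (n + 2) * (n + 2) := by
  have h1 : loose k X ≤ k := loose_le
  have h2 : (n + 2) * ambig k X ≤ (n + 2) * n := Nat.mul_le_mul_left _ (ambig_le.trans hk)
  unfold weight
  have : (n + 2) * (n + 2) = (n + 2) * n + 2 * (n + 2) := by ring
  omega

/-- Since the current colour of `u` is not admissible, `shape` speaks of all its admissible colours:
they lie in {2, 4}, or there is at most one. The summand 1 accounts for the node itself. -/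
theorem Valid.sum_weight (h : Valid A L k X) (hk : k ≤ n) (hu : u < k)
    (hbad : X u (X u 0) = 0) :
    (∑ d ∈ Finset.range 4, if X u (d + 1) = 1 then weight n k (Stub.child A u (d + 1) X) else 0)
      + 1 ≤ weight n k X := by
  have hne : ∀ j, X u j = 1 → j ≠ X u 0 := fun j hj h => by rw [← h] at hbad; omega
  have hw : ∀ c, 1 ≤ c → c ≤ 4 → X u c = 1 →
      weight n k (Stub.child A u c X) + 1 ≤ weight n k X := by
    intro c h1 h4 huc
    have a1 := loose_child (A := A) hu hbad h1 h4 huc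
    have a2 := Nat.mul_le_mul_left (n + 2) (ambig_child (A := A) (k := k) (u := u) (c := c) (X := X))
    unfold weight; omega
  have hpos : 1 ≤ weight n k X := by unfold weight; omega
  -- `loose` is counted twice on the left. The excess is at most k ≤ n and is covered by the n + 2
  -- units from `ambig_children`.
  have h24 : X u 2 = 1 → X u 4 = 1 →
      weight n k (Stub.child A u 2 X) + weight n k (Stub.child A u 4 X) + 1 ≤ weight n k X := by
    intro h2 h4
    have a1 := loose_child (A := A) hu hbad (by omega) (by omega) h2
    have a2 := loose_child (A := A) hu hbad (by omega) (by omega) h4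
    have a3 := Nat.mul_le_mul_left (n + 2) (ambig_children (A := A) hu h2 h4)
    have a4 : loose k X ≤ k := loose_le
    simp only [Nat.mul_add, Nat.mul_one] at a3
    unfold weight; omega
  simp only [Finset.sum_range_succ, Finset.sum_range_zero, zero_add, Nat.reduceAdd]
  have s1 := hw 1; have s2 := hw 2; have s3 := hw 3; have s4 := hw 4
  have key : (X u 1 ≠ 1 ∧ X u 3 ≠ 1) ∨
      ∀ i j, 1 ≤ i → i ≤ 4 → 1 ≤ j → j ≤ 4 → X u i = 1 → X u j = 1 → i = j := by
    rcases h.shape u hu with h' | h'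
    · left
      constructor <;> intro h1
      · have := h' 1 (by omega) (by omega) h1 (hne _ h1); omega
      · have := h' 3 (by omega) (by omega) h1 (hne _ h1); omega
    · exact .inr fun i j a b c d e f => h' i j a b c d e f (hne _ e) (hne _ f)
  rcases key with ⟨h1, h3⟩ | hs
  · rw [if_neg h1, if_neg h3]
    split_ifs with h2 h4 h4
    · have := h24 h2 h4; omega
    · have := s2 (by omega) (by omega) h2; omega
    · have := s4 (by omega) (by omega) h4; omega
    · omega
  · have hx : ∀ i j, i ≠ j → 1 ≤ i → i ≤ 4 → 1 ≤ j → j ≤ 4 → X u i = 1 → X u j ≠ 1 :=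
      fun i j hij a b c d e f => hij (hs i j a b c d e f)
    by_cases h1 : X u 1 = 1
    · rw [if_pos h1, if_neg (hx 1 2 (by simp) (by simp) (by simp) (by simp) (by simp) h1),
        if_neg (hx 1 3 (by simp) (by simp) (by simp) (by simp) (by simp) h1),
        if_neg (hx 1 4 (by simp) (by simp) (by simp) (by simp) (by simp) h1)]
      exact s1 (by simp) (by simp) h1
    rw [if_neg h1, zero_add]
    by_cases h2 : X u 2 = 1
    · rw [if_pos h2, if_neg (hx 2 3 (by simp) (by simp) (by simp) (by simp) (by simp) h2),
        if_neg (hx 2 4 (by simp) (by simp) (by simp) (by simp) (by simp) h2)]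
      exact s2 (by simp) (by simp) h2
    rw [if_neg h2, zero_add]
    by_cases h3 : X u 3 = 1
    · rw [if_pos h3, if_neg (hx 3 4 (by simp) (by simp) (by simp) (by simp) (by simp) h3)]
      exact s3 (by simp) (by simp) h3
    rw [if_neg h3, zero_add]
    split_ifs with h4
    exacts [s4 (by simp) (by simp) h4, by simpa using hpos]

/-! ### Guessing how the old colouring changes -/

/-- The colour that is prescribed for the vertex `w`, or `0`. -/
def seed (v k₁ k₂ s c w : ℕ) : ℕ :=
  if w = v then c else if w = s then 4 else if w = k₂ then 2 else if w = k₁ then 1 else 0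

/-- The initial state of the search, for the colouring `O` of the vertices below `v`. -/
def start (L : ℕ → ℕ → ℕ) (O : ℕ → ℕ) (v k₁ k₂ s c w j : ℕ) : ℕ :=
  if j = 0 then (if w = v then 0 else O w)
  else if seed v k₁ k₂ s c w = 0 then
    (if O w = 4 ∧ (j = 1 ∨ j = 2) ∨ O w = 2 ∧ j = 4 then 0 else L w j)
  else if seed v k₁ k₂ s c w = j then L w j else 0

/-- For `shape` at a vertex without prescribed colour: if `O w` is 1 or 3, the other of these is not
on the list by `hL3`, so the alternatives lie in {2, 4}. If `O w = 4`, only 3 is left as an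
alternative. If `O w = 2`, colour 4 is gone and 1 and 3 are not both present. For `pair`, `O` is
feasible and `v`, with current colour 0, is bad. -/
theorem start_valid {O : ℕ → ℕ} {v k₁ k₂ s : ℕ} (hL : ∀ w ≤ v, ∀ j, L w j = 0 ∨ L w j = 1)
    (hL3 : ∀ w ≤ v, L w 3 = 1 → L w 1 = 0) (hO : Sol A L v O) (hc : 1 ≤ c) :
    Valid A L (v + 1) (start L O v k₁ k₂ s c) := by
  have hle : ∀ w j, j ≠ 0 → start L O v k₁ k₂ s c w j = 0 ∨
      start L O v k₁ k₂ s c w j = L w j := by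
    intro w j hj
    unfold start
    rw [if_neg hj]
    split_ifs <;> simp
  have hv : start L O v k₁ k₂ s c v (start L O v k₁ k₂ s c v 0) = 0 := by
    simp [start]
  refine ⟨fun w hw j hj _ => ?_, fun w hw => ?_, fun x hx y hy hxy => ?_, fun w hw => ?_⟩
  · rcases hle w j (by omega) with h | h
    · exact .inl h
    · rw [h]
      rcases hL w (by omega) j with h' | h' <;> simp [h']
  · unfold start
    rw [if_pos rfl]
    split_ifs with h
    · omega
    · exact (hO.1 w (by omega)).2.1
  · by_cases hxv : x = v
    · subst hxv; exact .inl hv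
    · by_cases hyv : y = v
      · subst hyv; exact .inr (.inl hv)
      · refine .inr (.inr ?_)
        have := hO.2 x (by omega) y (by omega) hxy
        simpa [start, hxv, hyv] using this
  · by_cases hs : seed v k₁ k₂ s c w = 0
    · have hwv : w ≠ v := fun h => by subst h; simp [seed] at hs; omega
      obtain ⟨h1, h4, hLw⟩ := hO.1 w (by omega)
      have h0 : start L O v k₁ k₂ s c w 0 = O w := by simp [start, hwv]
      have hj : ∀ j, 1 ≤ j → start L O v k₁ k₂ s c w j = 1 →
          L w j = 1 ∧ ¬ (O w = 4 ∧ (j = 1 ∨ j = 2) ∨ O w = 2 ∧ j = 4) := by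
        intro j hj h
        simp only [start, if_neg (show j ≠ 0 by omega), if_pos hs] at h
        split_ifs at h with h'
        exact ⟨h, h'⟩
      have h3 := hL3 w (by omega)
      rw [h0]
      have : O w = 1 ∨ O w = 2 ∨ O w = 3 ∨ O w = 4 := by omega
      rcases this with h | h | h | h <;> rw [h] at hLw hj ⊢
      · left
        intro j h5 h6 h7 h8
        have := (hj j h5 h7).1
        by_contra h9
        obtain rfl : j = 3 := by omega
        have := h3 this; omega
      · right
        intro i j a1 a2 a3 a4 a5 a6 a7 a8
        have b1 := hj i a1 a5
        have b2 := hj j a3 a6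
        by_contra h9
        have : (i = 1 ∧ j = 3) ∨ (i = 3 ∧ j = 1) := by omega
        rcases this with ⟨rfl, rfl⟩ | ⟨rfl, rfl⟩
        · have := h3 b2.1; omega
        · have := h3 b1.1; omega
      · left
        intro j h5 h6 h7 h8
        have := (hj j h5 h7).1
        by_contra h9
        obtain rfl : j = 1 := by omega
        have := h3 hLw; omega
      · right
        intro i j a1 a2 a3 a4 a5 a6 a7 a8
        have b1 := hj i a1 a5
        have b2 := hj j a3 a6
        omega
    · right
      intro i j a1 a2 a3 a4 a5 a6 a7 a8
      simp only [start, if_neg (show i ≠ 0 by omega), if_neg (show j ≠ 0 by omega),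
        if_neg hs] at a5 a6
      split_ifs at a5 a6
      omega

/-- Two vertices of the same exceptional kind would be adjacent because of one colouring and
non-adjacent because of the other, so each kind has at most one vertex to be guessed. -/
theorem Has.sol_of_start {O : ℕ → ℕ} {v : ℕ} {N : ℕ → ℕ} (hO : Sol A L v O)
    (hN : Sol A L (v + 1) N) :
    ∃ k₁ ≤ v, ∃ k₂ ≤ v, ∃ s ≤ v, ∃ c < 4, Has A L (v + 1) (start L O v k₁ k₂ s (c + 1)) := by
  -- The default `z = v` stands for the absence of such a vertex. It is harmless because `seed`
  -- compares with `v` before all other guesses.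
  have pick : ∀ a b, (∀ x < v, ∀ y < v, x ≠ y → O x = a → O y = a → N x = b → N y = b → False) →
      ∃ z ≤ v, (z < v → O z = a ∧ N z = b) ∧ ∀ w < v, O w = a → N w = b → w = z := by
    intro a b h
    by_cases hex : ∃ z < v, O z = a ∧ N z = b
    · obtain ⟨z, hz, h1, h2⟩ := hex
      exact ⟨z, hz.le, fun _ => ⟨h1, h2⟩, fun w hw h3 h4 =>
        by_contra fun hne => h w hw z hz hne h3 h1 h4 h2⟩
    · push Not at hex
      exact ⟨v, le_rfl, fun h => absurd h (lt_irrefl v), fun w hw h1 h2 =>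
        absurd h2 (hex w hw h1)⟩
  have sep : ∀ x < v, ∀ y < v, x ≠ y → ¬ Conf (A x y) (O x) (O y) ∧ ¬ Conf (A x y) (N x) (N y) :=
    fun x hx y hy hxy => ⟨hO.2 x hx y hy hxy, hN.2 x (by omega) y (by omega) hxy⟩
  obtain ⟨k₁, hk₁, a1, b1⟩ := pick 4 1 fun x hx y hy hxy h1 h2 h3 h4 => by
    have := sep x hx y hy hxy
    rw [h1, h2, h3, h4] at this
    simp [Conf] at this
  obtain ⟨k₂, hk₂, a2, b2⟩ := pick 4 2 fun x hx y hy hxy h1 h2 h3 h4 => by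
    have := sep x hx y hy hxy
    rw [h1, h2, h3, h4] at this
    simp [Conf] at this
  obtain ⟨s, hs, a3, b3⟩ := pick 2 4 fun x hx y hy hxy h1 h2 h3 h4 => by
    have := sep x hx y hy hxy
    rw [h1, h2, h3, h4] at this
    simp [Conf] at this
  have hv := hN.1 v (by omega)
  refine ⟨k₁, hk₁, k₂, hk₂, s, hs, N v - 1, by omega, N, hN, fun w hw => ?_⟩
  rw [Nat.sub_add_cancel hv.1]
  obtain ⟨h1, h4, hLw⟩ := hN.1 w hw
  by_cases hwv : w = v
  · subst hwv
    simp only [start, seed, if_true]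
    rw [if_neg (by omega), if_neg (by omega), hLw]
  have hwv' : w < v := by omega
  have hseed : seed v k₁ k₂ s (N v) w = 0 ∨ seed v k₁ k₂ s (N v) w = N w := by
    unfold seed
    rw [if_neg hwv]
    split_ifs with e1 e2 e3
    · subst e1; exact .inr (a3 hwv').2.symm
    · subst e2; exact .inr (a2 hwv').2.symm
    · subst e3; exact .inr (a1 hwv').2.symm
    · exact .inl rfl
  unfold start
  rw [if_neg (by omega)]
  by_cases h0 : seed v k₁ k₂ s (N v) w = 0
  -- A vertex without prescribed colour is not exceptional, so the colours that `start` strikes are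
  -- not the one used by `N`.
  · have hne : w ≠ s ∧ w ≠ k₂ ∧ w ≠ k₁ := by
      unfold seed at h0
      rw [if_neg hwv] at h0
      split_ifs at h0 with e1 e2 e3
      exact ⟨e1, e2, e3⟩
    rw [if_pos h0, if_neg, hLw]
    have c1 := b1 w hwv'; have c2 := b2 w hwv'; have c3 := b3 w hwv'
    omega
  · rw [if_neg h0, if_pos (by tauto), hLw]

end Stub

/-! ### The program -/

namespace Stub

open BL

/- The variables: `0` the answer, `1` the number of vertices, `2` the number of edges, `3` the
vertex `v` that is added, `4`, `5`, `6`, `7` the guesses `k₁`, `k₂`, `s`, `c`, `8` the state under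
consideration, `9` a row, `10` a bad vertex, `11` the number of states, `12` whether a colouring has
been found, `13` a colour, `14` a prescribed colour, `15`, `16` the ends of an edge and
`17, …, 21` the entries of a row. -/

/-- The constants follow the assignments. A colour computed as variable 13 plus 1 gets the constant
5, which is also the constant of the memory bound. The number n, loaded from memory, has type (5,
1). Hence vertex numbers bounded by v + 1 get (6, 1), and the state bound (n + 2)² gets (49, 2). -/
def types : ℕ → ℕ × ℕ
  | 0 => (1, 0)
  | 3 => (5, 1)
  | 4 | 5 | 6 | 9 | 10 => (6, 1)
  | 7 | 13 => (4, 0)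
  | 8 | 11 => (49, 2)
  | 12 => (1, 0)
  | 14 => (5, 0)
  | _ => (5, 1)

abbrev plus (e : Expr) (c : ℕ) : Expr := .add e (.lit c)

/-- The start of the adjacency matrix. -/
def baseA (n m : ℕ) : ℕ := 2 + 4 * n + 2 * m

/-- The start of the current colouring. -/
def baseO (n m : ℕ) : ℕ := baseA n m + n * n

/-- The address of an entry of a state. -/
def fr (n m h w j : ℕ) : ℕ := baseO n m + n + (5 * (h * n + w) + j)

def eA : Expr := .add (.add (.lit 2) (.mul (.lit 4) (.var 1))) (.mul (.lit 2) (.var 2))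

def eO : Expr := .add eA (.mul (.var 1) (.var 1))

/-- The offset is 1 because two header words precede the lists and `j` starts at 1. -/
def eList (w : Expr) (j : ℕ) : Expr := .add (.add (.lit 1) (.mul (.lit 4) w)) (.lit j)

def eAdj (u w : Expr) : Expr := .add eA (.add (.mul (.var 1) u) w)

def eCol (w : Expr) : Expr := .add eO w

def eFr (h w j : Expr) : Expr :=
  .add (.add eO (.var 1)) (.add (.mul (.lit 5) (.add (.mul h (.var 1)) w)) j)

@[simp] theorem eval_eA (σ : RAM.State) : eA.eval σ = baseA (σ.reg 1) (σ.reg 2) := rfl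

@[simp] theorem eval_eO (σ : RAM.State) : eO.eval σ = baseO (σ.reg 1) (σ.reg 2) := rfl

@[simp] theorem eval_eList (σ : RAM.State) (w : Expr) (j : ℕ) :
    (eList w j).eval σ = 1 + 4 * w.eval σ + j := rfl

@[simp] theorem eval_eAdj (σ : RAM.State) (u w : Expr) :
    (eAdj u w).eval σ = baseA (σ.reg 1) (σ.reg 2) + (σ.reg 1 * u.eval σ + w.eval σ) := rfl

@[simp] theorem eval_eCol (σ : RAM.State) (w : Expr) :
    (eCol w).eval σ = baseO (σ.reg 1) (σ.reg 2) + w.eval σ := rfl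

@[simp] theorem eval_eFr (σ : RAM.State) (h w j : Expr) :
    (eFr h w j).eval σ = fr (σ.reg 1) (σ.reg 2) (h.eval σ) (w.eval σ) (j.eval σ) := rfl

def dropOne : Cmd :=
  .for_ 9 (.var 1) (.ifeq (.ld (eList (.var 9) 3)) (.lit 1) (.sto (eList (.var 9) 1) (.lit 0)) .skip)

def eEdge (j : ℕ) : Expr :=
  .ld (.add (.add (.add (.lit 2) (.mul (.lit 4) (.var 1))) (.mul (.lit 2) (.var 9))) (.lit j))

def readEdges : Cmd :=
  .for_ 9 (.var 2) (.seq (.set 15 (eEdge 0)) (.seq (.set 16 (eEdge 1))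
    (.seq (.sto (eAdj (.var 15) (.var 16)) (.lit 1)) (.sto (eAdj (.var 16) (.var 15)) (.lit 1)))))

/-- Store the variables `17, …, 21` as row `9` of the state `h`. -/
def storeRow (h : Expr) : Cmd :=
  .seq (.sto (eFr h (.var 9) (.lit 0)) (.var 17)) (.seq (.sto (eFr h (.var 9) (.lit 1)) (.var 18))
    (.seq (.sto (eFr h (.var 9) (.lit 2)) (.var 19)) (.seq (.sto (eFr h (.var 9) (.lit 3)) (.var 20))
      (.sto (eFr h (.var 9) (.lit 4)) (.var 21)))))

def seedCmd : Cmd :=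
  .ifeq (.var 9) (.var 3) (.set 14 (plus (.var 7) 1)) (.ifeq (.var 9) (.var 6) (.set 14 (.lit 4))
    (.ifeq (.var 9) (.var 5) (.set 14 (.lit 2)) (.ifeq (.var 9) (.var 4) (.set 14 (.lit 1))
      (.set 14 (.lit 0)))))

def startCur : Cmd :=
  .ifeq (.var 9) (.var 3) (.set 17 (.lit 0)) (.set 17 (.ld (eCol (.var 9))))

def startBit (j : ℕ) : Cmd :=
  .ifeq (.var 14) (.lit 0)
    (.ifeq (.ld (eCol (.var 9))) (.lit 4)
      (.set (17 + j) (if j = 1 ∨ j = 2 then .lit 0 else .ld (eList (.var 9) j)))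
      (.ifeq (.ld (eCol (.var 9))) (.lit 2)
        (.set (17 + j) (if j = 4 then .lit 0 else .ld (eList (.var 9) j)))
        (.set (17 + j) (.ld (eList (.var 9) j)))))
    (.ifeq (.var 14) (.lit j) (.set (17 + j) (.ld (eList (.var 9) j))) (.set (17 + j) (.lit 0)))

def startRow : Cmd :=
  .seq seedCmd (.seq startCur (.seq (startBit 1) (.seq (startBit 2) (.seq (startBit 3)
    (startBit 4)))))

def startAll : Cmd := .for_ 9 (plus (.var 3) 1) (.seq startRow (storeRow (.lit 0)))

def childBit (j : ℕ) : Cmd := .ifeq (plus (.var 13) 1) (.lit j) (.set (17 + j) (.lit 1))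
  (.set (17 + j) (.lit 0))

def copyEntry (j : ℕ) : Cmd := .set (17 + j) (.ld (eFr (.var 8) (.var 9) (.lit j)))

/-- Variable 13 holds the new colour minus 1, and the variables 18 to 21 hold the admissibility of
the colours 1 to 4. -/
def clearConf : Cmd :=
  .ifeq (.ld (eAdj (.var 10) (.var 9))) (.lit 1)
    (.ifeq (.var 13) (.lit 0) (.seq (.set 18 (.lit 0)) (.set 20 (.lit 0)))
      (.ifeq (.var 13) (.lit 1) (.set 19 (.lit 0))
        (.ifeq (.var 13) (.lit 2) (.set 18 (.lit 0)) .skip)))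
    (.ifeq (.var 13) (.lit 3) (.set 21 (.lit 0)) .skip)

def childRow : Cmd :=
  .ifeq (.var 9) (.var 10)
    (.seq (.set 17 (plus (.var 13) 1)) (.seq (childBit 1) (.seq (childBit 2) (.seq (childBit 3)
      (childBit 4)))))
    (.seq (.seq (copyEntry 0) (.seq (copyEntry 1) (.seq (copyEntry 2) (.seq (copyEntry 3)
      (copyEntry 4))))) clearConf)

def childAll : Cmd := .for_ 9 (plus (.var 3) 1) (.seq childRow (storeRow (.var 11)))

/-- A bound for the number of states. -/
def eLim : Expr := .mul (plus (.var 1) 2) (plus (.var 1) 2)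

/-- The double truncated subtraction is the minimum of `eLim` and the increased counter. It gives
variable 11 the static type of `eLim`, which a plain increment would exceed. The cap is never
reached from below by more than equality, as `expand_spec` shows. -/
def expand : Cmd :=
  .for_ 13 (.lit 4) (.ifeq (.ld (eFr (.var 8) (.var 10) (plus (.var 13) 1))) (.lit 1)
    (.seq childAll (.set 11 (.sub eLim (.sub eLim (plus (.var 11) 1))))) .skip)

/-- The value v + 1 signals that no vertex is bad. -/
def findBad : Cmd :=
  .seq (.set 10 (plus (.var 3) 1)) (.for_ 9 (plus (.var 3) 1)
    (.ifeq (.ld (eFr (.var 8) (.var 9) (.ld (eFr (.var 8) (.var 9) (.lit 0))))) (.lit 0)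
      (.set 10 (.var 9)) .skip))

def accept : Cmd :=
  .seq (.set 12 (.lit 1)) (.for_ 9 (plus (.var 3) 1)
    (.sto (eCol (.var 9)) (.ld (eFr (.var 8) (.var 9) (.lit 0)))))

def process : Cmd := .seq findBad (.ifeq (.var 10) (plus (.var 3) 1) accept expand)

/-- A breadth-first queue. A loop bound is evaluated only once, so the loop visits all `eLim`
indices and idles when no state is pending or a colouring has been found. -/
def search : Cmd :=
  .seq (.set 11 (.lit 1)) (.for_ 8 eLim (.iflt (.var 8) (.var 11)
    (.ifeq (.var 12) (.lit 0) process .skip) .skip))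

/-- After a success the stored colouring has been overwritten, so the remaining guesses must be
skipped. -/
def trySeeds : Cmd := .ifeq (.var 12) (.lit 0) (.seq startAll search) .skip

def tryAll : Cmd :=
  .for_ 4 (plus (.var 3) 1) (.for_ 5 (plus (.var 3) 1) (.for_ 6 (plus (.var 3) 1)
    (.for_ 7 (.lit 4) trySeeds)))

def stage : Cmd :=
  .seq (.set 12 (.lit 0)) (.seq tryAll (.ifeq (.var 12) (.lit 0) (.set 0 (.lit 0)) .skip))

def solve : Cmd := .for_ 3 (.var 1) (.ifeq (.var 0) (.lit 1) stage .skip)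

def main : Cmd :=
  .seq (.set 1 (.ld (.lit 0))) (.seq (.set 2 (.ld (.lit 1))) (.seq dropOne (.seq readEdges
    (.seq (.set 0 (.lit 1)) solve))))

theorem main_check : main.check types = true := by decide

/-- One factor for the vertex that is added, three for the guessed vertices, two for the states and
one for the rows of a state; the loops over colours have constant length. -/
theorem main_cost : (main.cost types).2 = 7 := by decide

/-! ### Rows and states -/

/-- The expression is evaluated anew between stores, so `he` asks that its value depend on registers
only. -/
theorem storeRow_spec {e : Expr} {σ : RAM.State} {h : ℕ}
    (he : ∀ τ : RAM.State, τ.reg = σ.reg → e.eval τ = h) :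
    (∀ j < 5, ((storeRow e).run σ).mem (fr (σ.reg 1) (σ.reg 2) h (σ.reg 9) j) = σ.reg (17 + j)) ∧
    ∀ a, (a < fr (σ.reg 1) (σ.reg 2) h (σ.reg 9) 0 ∨
      fr (σ.reg 1) (σ.reg 2) h (σ.reg 9) 0 + 5 ≤ a) →
      ((storeRow e).run σ).mem a = σ.mem a := by
  have hm : ((storeRow e).run σ).mem = fun a =>
      if a = fr (σ.reg 1) (σ.reg 2) h (σ.reg 9) 4 then σ.reg 21 else
      if a = fr (σ.reg 1) (σ.reg 2) h (σ.reg 9) 3 then σ.reg 20 else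
      if a = fr (σ.reg 1) (σ.reg 2) h (σ.reg 9) 2 then σ.reg 19 else
      if a = fr (σ.reg 1) (σ.reg 2) h (σ.reg 9) 1 then σ.reg 18 else
      if a = fr (σ.reg 1) (σ.reg 2) h (σ.reg 9) 0 then σ.reg 17 else σ.mem a := by
    funext a
    simp [storeRow, Cmd.run, setM, Expr.eval, he, Function.update_apply]
  rw [hm]
  constructor
  · intro j hj
    unfold fr
    interval_cases j <;> simp
  · intro a ha
    unfold fr at *
    simp only
    rw [if_neg, if_neg, if_neg, if_neg, if_neg] <;> omega

theorem seedCmd_spec (σ : RAM.State) : (seedCmd.run σ).reg 14 =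
    seed (σ.reg 3) (σ.reg 4) (σ.reg 5) (σ.reg 6) (σ.reg 7 + 1) (σ.reg 9) := by
  by_cases h3 : σ.reg 9 = σ.reg 3
  · simp [seedCmd, Cmd.run, seed, Expr.eval, setR, h3]
  by_cases h6 : σ.reg 9 = σ.reg 6
  · rw [h6] at h3
    simp [seedCmd, Cmd.run, seed, Expr.eval, setR, h3, h6]
  by_cases h5 : σ.reg 9 = σ.reg 5
  · rw [h5] at h3 h6
    simp [seedCmd, Cmd.run, seed, Expr.eval, setR, h3, h6, h5]
  by_cases h4 : σ.reg 9 = σ.reg 4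
  · rw [h4] at h3 h6 h5
    simp [seedCmd, Cmd.run, seed, Expr.eval, setR, h3, h6, h5, h4]
  · simp [seedCmd, Cmd.run, seed, Expr.eval, setR, h3, h6, h5, h4]

theorem startBit_spec (σ : RAM.State) {j : ℕ} :
    ((startBit j).run σ).reg (17 + j) =
      if σ.reg 14 = 0 then
        (if σ.mem (baseO (σ.reg 1) (σ.reg 2) + σ.reg 9) = 4 ∧ (j = 1 ∨ j = 2) ∨
          σ.mem (baseO (σ.reg 1) (σ.reg 2) + σ.reg 9) = 2 ∧ j = 4 then 0
          else σ.mem (1 + 4 * σ.reg 9 + j))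
      else if σ.reg 14 = j then σ.mem (1 + 4 * σ.reg 9 + j) else 0 := by
  by_cases h0 : σ.reg 14 = 0
  · by_cases h4 : σ.mem (baseO (σ.reg 1) (σ.reg 2) + σ.reg 9) = 4
    · by_cases hj : j = 1 ∨ j = 2 <;> simp [startBit, Cmd.run, setR, h0, h4, hj, Expr.eval]
    · by_cases h2 : σ.mem (baseO (σ.reg 1) (σ.reg 2) + σ.reg 9) = 2
      · by_cases hj : j = 4 <;> simp [startBit, Cmd.run, setR, h0, h2, hj, Expr.eval]
      · simp [startBit, Cmd.run, setR, h0, h4, h2, Expr.eval]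
  · by_cases hj : σ.reg 14 = j
    · have : j ≠ 0 := fun h => h0 (hj.trans h)
      simp [startBit, Cmd.run, setR, this, hj, Expr.eval]
    · simp [startBit, Cmd.run, setR, h0, hj, Expr.eval]

theorem startRow_spec {L : ℕ → ℕ → ℕ} {O : ℕ → ℕ} {v k₁ k₂ s c w : ℕ} {σ : RAM.State}
    (h3 : σ.reg 3 = v) (h4 : σ.reg 4 = k₁) (h5 : σ.reg 5 = k₂) (h6 : σ.reg 6 = s)
    (h7 : σ.reg 7 = c) (h9 : σ.reg 9 = w)
    (hL : ∀ j, 1 ≤ j → j ≤ 4 → σ.mem (1 + 4 * w + j) = L w j)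
    (hO : w ≠ v → σ.mem (baseO (σ.reg 1) (σ.reg 2) + w) = O w) {j : ℕ} (hj : j < 5) :
    (startRow.run σ).reg (17 + j) = start L O v k₁ k₂ s (c + 1) w j := by
  set σ₁ := seedCmd.run σ with e₁
  set σ₂ := startCur.run σ₁ with e₂
  set σ₃ := (startBit 1).run σ₂ with e₃
  set σ₄ := (startBit 2).run σ₃ with e₄
  set σ₅ := (startBit 3).run σ₄ with e₅
  have hrun : startRow.run σ = (startBit 4).run σ₅ := rfl
  have hm₁ : σ₁.mem = σ.mem := Cmd.run_mem _ _ rfl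
  have hm₂ : σ₂.mem = σ.mem := (Cmd.run_mem _ _ rfl).trans hm₁
  have hm₃ : σ₃.mem = σ.mem := (Cmd.run_mem _ _ rfl).trans hm₂
  have hm₄ : σ₄.mem = σ.mem := (Cmd.run_mem _ _ rfl).trans hm₃
  have hm₅ : σ₅.mem = σ.mem := (Cmd.run_mem _ _ rfl).trans hm₄
  have r₁ : ∀ y, y ≠ 14 → σ₁.reg y = σ.reg y := fun y hy =>
    Cmd.run_reg _ _ (by simpa [seedCmd, Cmd.mods] using hy)
  have r₂ : ∀ y, y ≠ 17 → σ₂.reg y = σ₁.reg y := fun y hy =>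
    Cmd.run_reg _ _ (by simpa [startCur, Cmd.mods] using hy)
  have r₃ : ∀ y, y ≠ 18 → σ₃.reg y = σ₂.reg y := fun y hy =>
    Cmd.run_reg _ _ (by simpa [startBit, Cmd.mods] using hy)
  have r₄ : ∀ y, y ≠ 19 → σ₄.reg y = σ₃.reg y := fun y hy =>
    Cmd.run_reg _ _ (by simpa [startBit, Cmd.mods] using hy)
  have r₅ : ∀ y, y ≠ 20 → σ₅.reg y = σ₄.reg y := fun y hy =>
    Cmd.run_reg _ _ (by simpa [startBit, Cmd.mods] using hy)
  have r₆ : ∀ y, y ≠ 21 → (startRow.run σ).reg y = σ₅.reg y := fun y hy => by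
    rw [hrun]; exact Cmd.run_reg _ _ (by simpa [startBit, Cmd.mods] using hy)
  have hq : σ₁.reg 14 = seed v k₁ k₂ s (c + 1) w := by
    rw [e₁, seedCmd_spec, h3, h4, h5, h6, h7, h9]
  have hbit : ∀ τ : RAM.State, ∀ j, 1 ≤ j → j ≤ 4 → τ.mem = σ.mem → τ.reg 1 = σ.reg 1 →
      τ.reg 2 = σ.reg 2 → τ.reg 9 = σ.reg 9 → τ.reg 14 = σ₁.reg 14 →
      ((startBit j).run τ).reg (17 + j) = start L O v k₁ k₂ s (c + 1) w j := by
    intro τ j hj1 hj4 hm a1 a2 a9 a14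
    rw [startBit_spec, hm, a1, a2, a9, a14, hq, h9, hL j hj1 hj4]
    unfold start
    rw [if_neg (show j ≠ 0 by omega)]
    by_cases hwv : w = v
    · have : seed v k₁ k₂ s (c + 1) w ≠ 0 := by simp [seed, hwv]
      rw [if_neg this, if_neg this]
    · rw [hO hwv]
  interval_cases j
  · rw [r₆ _ (by decide), r₅ _ (by decide), r₄ _ (by decide), r₃ _ (by decide), e₂]
    simp only [startCur, Cmd.run, Expr.eval, eval_eCol, r₁ 9 (by decide), r₁ 3 (by decide),
      r₁ 1 (by decide), r₁ 2 (by decide), h9, h3, hm₁, start]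
    by_cases hwv : w = v
    · simp [hwv, setR]
    · simp [hwv, setR, hO hwv]
  · rw [r₆ _ (by decide), r₅ _ (by decide), r₄ _ (by decide)]
    exact hbit σ₂ 1 (by decide) (by decide) hm₂ (by rw [r₂ _ (by decide), r₁ _ (by decide)])
      (by rw [r₂ _ (by decide), r₁ _ (by decide)]) (by rw [r₂ _ (by decide), r₁ _ (by decide)])
      (r₂ _ (by decide))
  · rw [r₆ _ (by decide), r₅ _ (by decide)]
    exact hbit σ₃ 2 (by decide) (by decide) hm₃
      (by rw [r₃ _ (by decide), r₂ _ (by decide), r₁ _ (by decide)])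
      (by rw [r₃ _ (by decide), r₂ _ (by decide), r₁ _ (by decide)])
      (by rw [r₃ _ (by decide), r₂ _ (by decide), r₁ _ (by decide)])
      (by rw [r₃ _ (by decide), r₂ _ (by decide)])
  · rw [r₆ _ (by decide)]
    exact hbit σ₄ 3 (by decide) (by decide) hm₄
      (by rw [r₄ _ (by decide), r₃ _ (by decide), r₂ _ (by decide), r₁ _ (by decide)])
      (by rw [r₄ _ (by decide), r₃ _ (by decide), r₂ _ (by decide), r₁ _ (by decide)])
      (by rw [r₄ _ (by decide), r₃ _ (by decide), r₂ _ (by decide), r₁ _ (by decide)])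
      (by rw [r₄ _ (by decide), r₃ _ (by decide), r₂ _ (by decide)])
  · rw [hrun]
    exact hbit σ₅ 4 (by decide) (by decide) hm₅
      (by rw [r₅ _ (by decide), r₄ _ (by decide), r₃ _ (by decide), r₂ _ (by decide),
        r₁ _ (by decide)])
      (by rw [r₅ _ (by decide), r₄ _ (by decide), r₃ _ (by decide), r₂ _ (by decide),
        r₁ _ (by decide)])
      (by rw [r₅ _ (by decide), r₄ _ (by decide), r₃ _ (by decide), r₂ _ (by decide),
        r₁ _ (by decide)])
      (by rw [r₅ _ (by decide), r₄ _ (by decide), r₃ _ (by decide), r₂ _ (by decide)])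

theorem childRow_spec {A X : ℕ → ℕ → ℕ} {h u d w : ℕ} {σ : RAM.State}
    (h8 : σ.reg 8 = h) (h10 : σ.reg 10 = u) (h13 : σ.reg 13 = d) (h9 : σ.reg 9 = w)
    (hX : ∀ j < 5, σ.mem (fr (σ.reg 1) (σ.reg 2) h w j) = X w j)
    (hA : σ.mem (baseA (σ.reg 1) (σ.reg 2) + (σ.reg 1 * u + w)) = A u w) (hd : d < 4)
    {j : ℕ} (hj : j < 5) :
    (childRow.run σ).reg (17 + j) = child A u (d + 1) X w j := by
  by_cases hwu : w = u
  · simp only [childRow, Cmd.run, Expr.eval, h9, h10, if_pos hwu, child]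
    simp only [childBit, Cmd.run, Expr.eval]
    interval_cases d <;> interval_cases j <;> simp [setR, h13]
  · simp only [childRow, Cmd.run, Expr.eval, h9, h10, if_neg hwu, child]
    set τ := (copyEntry 4).run ((copyEntry 3).run ((copyEntry 2).run ((copyEntry 1).run
      ((copyEntry 0).run σ)))) with hτ
    have hm : τ.mem = σ.mem := by simp [hτ, copyEntry, Cmd.run, setR]
    have hr : ∀ y < 17, τ.reg y = σ.reg y := by
      intro y hy
      rw [hτ]
      simp only [copyEntry, Cmd.run, setR]
      rw [Function.update_of_ne (by omega), Function.update_of_ne (by omega),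
        Function.update_of_ne (by omega), Function.update_of_ne (by omega),
        Function.update_of_ne (by omega)]
    have hx : ∀ j < 5, τ.reg (17 + j) = X w j := by
      intro j hj
      rw [← hX j hj, hτ]
      simp only [copyEntry, Cmd.run, setR]
      interval_cases j <;> simp [Expr.eval, h8, h9]
    have x0 := hx 0 (by omega); have x1 := hx 1 (by omega); have x2 := hx 2 (by omega)
    have x3 := hx 3 (by omega); have x4 := hx 4 (by omega)
    simp only [Nat.reduceAdd] at x0 x1 x2 x3 x4
    simp only [clearConf, Cmd.run, Expr.eval, eval_eAdj, hm, hr 1 (by omega), hr 2 (by omega),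
      hr 9 (by omega), hr 10 (by omega), hr 13 (by omega), h9, h10, h13, hA]
    by_cases ha : A u w = 1 <;> interval_cases d <;> interval_cases j <;>
      simp [setR, ha, Conf, x0, x1, x2, x3, x4]

/-! ### Loops over rows -/

/-- States occupy consecutive blocks of 5 * n cells, so writing the state `t` leaves all earlier
ones intact. -/
theorem fr_lt {n m h t w j : ℕ} (ht : h < t) (hw : w < n) (hj : j < 5) :
    fr n m h w j < fr n m t 0 0 := by
  have h1 : (h + 1) * n ≤ t * n := Nat.mul_le_mul_right _ ht
  rw [Nat.add_mul, Nat.one_mul] at h1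
  unfold fr; omega

theorem baseO_lt_fr {n m h w j a : ℕ} (ha : a < n) : baseO n m + a < fr n m h w j := by
  unfold fr; omega

/-- The part of the memory that is fixed after the preparations: the reduced lists `L` and the
adjacency matrix `A`. -/
structure Stat (A L : ℕ → ℕ → ℕ) (n m : ℕ) (σ : RAM.State) : Prop where
  r1 : σ.reg 1 = n
  r2 : σ.reg 2 = m
  list : ∀ w < n, ∀ j, 1 ≤ j → j ≤ 4 → σ.mem (1 + 4 * w + j) = L w j
  adj : ∀ u < n, ∀ w < n, σ.mem (baseA n m + (n * u + w)) = A u w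

variable {A L X : ℕ → ℕ → ℕ} {O : ℕ → ℕ} {n m v : ℕ} {σ τ : RAM.State}

theorem Stat.congr (h : Stat A L n m σ) (h1 : τ.reg 1 = σ.reg 1) (h2 : τ.reg 2 = σ.reg 2)
    (hm : ∀ a < baseO n m, τ.mem a = σ.mem a) : Stat A L n m τ := by
  refine ⟨h1.trans h.r1, h2.trans h.r2, fun w hw j hj hj4 => ?_, fun u hu w hw => ?_⟩
  · rw [hm _ (by unfold baseO baseA; omega)]
    exact h.list w hw j hj hj4
  · have : n * (u + 1) ≤ n * n := Nat.mul_le_mul_left _ hu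
    rw [Nat.mul_add, Nat.mul_one] at this
    rw [hm _ (by unfold baseO; omega)]
    exact h.adj u hu w hw

/-- The state number `h` of the search is `X`. -/
def Frame (n m k h : ℕ) (X : ℕ → ℕ → ℕ) (σ : RAM.State) : Prop :=
  ∀ w < k, ∀ j < 5, σ.mem (fr n m h w j) = X w j

/-- The colouring that is stored is `O`. -/
def Col (n m k : ℕ) (O : ℕ → ℕ) (σ : RAM.State) : Prop :=
  ∀ w < k, σ.mem (baseO n m + w) = O w

theorem Frame.congr {k h t : ℕ} (hX : Frame n m k h X σ) (hk : k ≤ n) (ht : h < t)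
    (hm : ∀ a < fr n m t 0 0, τ.mem a = σ.mem a) : Frame n m k h X τ := fun w hw j hj => by
  rw [hm _ (fr_lt ht (by omega) hj)]
  exact hX w hw j hj

theorem Col.congr {k t : ℕ} (hO : Col n m k O σ) (hk : k ≤ n)
    (hm : ∀ a < fr n m t 0 0, τ.mem a = σ.mem a) : Col n m k O τ := fun w hw => by
  rw [hm _ (baseO_lt_fr (by omega))]
  exact hO w hw

theorem Stat.congr_fr {t : ℕ} (h : Stat A L n m σ) (h1 : τ.reg 1 = σ.reg 1)
    (h2 : τ.reg 2 = σ.reg 2) (hm : ∀ a < fr n m t 0 0, τ.mem a = σ.mem a) : Stat A L n m τ :=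
  h.congr h1 h2 fun a ha => hm a (by unfold fr; omega)

/-- A loop that computes the rows of the state `t`, one by one, and stores them. -/
theorem rows_spec {body : Cmd} {e : Expr} {t : ℕ} {Y : ℕ → ℕ → ℕ} (hb : body.pure = true)
    (hmods : ∀ y < 14, y ∉ body.mods)
    (h1 : σ.reg 1 = n) (h2 : σ.reg 2 = m) (h3 : σ.reg 3 = v)
    (he : ∀ ρ : RAM.State, (∀ y < 9, ρ.reg y = σ.reg y) → ρ.reg 11 = σ.reg 11 → e.eval ρ = t)
    (hrow : ∀ ρ : RAM.State, ∀ w < v + 1, (∀ y < 14, y ≠ 9 → ρ.reg y = σ.reg y) → ρ.reg 9 = w →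
      (∀ a < fr n m t 0 0, ρ.mem a = σ.mem a) → ∀ j < 5, (body.run ρ).reg (17 + j) = Y w j) :
    Frame n m (v + 1) t Y ((Cmd.for_ 9 (plus (.var 3) 1) (.seq body (storeRow e))).run σ) ∧
    ∀ a < fr n m t 0 0,
      ((Cmd.for_ 9 (plus (.var 3) 1) (.seq body (storeRow e))).run σ).mem a = σ.mem a := by
  have hev : (plus (.var 3) 1).eval σ = v + 1 := by simp [Expr.eval, h3]
  have key := Cmd.run_for (x := 9) (e := plus (.var 3) 1) (p := .seq body (storeRow e)) (σ := σ)
    (fun i ρ => Frame n m i t Y ρ ∧ ∀ a < fr n m t 0 0, ρ.mem a = σ.mem a)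
    ⟨fun w hw => absurd hw (by omega), fun _ _ => rfl⟩ ?_
  · rwa [hev] at key
  · rintro i τ hi hreg ⟨hF, hlow⟩
    rw [hev] at hi
    have hreg' : ∀ y < 14, y ≠ 9 → τ.reg y = σ.reg y := fun y hy hy9 => hreg y (by
      simp only [Cmd.mods, storeRow, List.append_nil, List.mem_cons, not_or]
      exact ⟨hy9, hmods y hy⟩)
    set ρ := setR τ 9 i with hρ
    have ρ9 : ρ.reg 9 = i := by simp [hρ, setR]
    have ρr : ∀ y < 14, y ≠ 9 → ρ.reg y = σ.reg y := fun y hy hy9 => by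
      rw [← hreg' y hy hy9]; exact Function.update_of_ne hy9 _ _
    have hval := hrow ρ i hi ρr ρ9 hlow
    set ρ' := body.run ρ with hρ'
    have ρm : ρ'.mem = τ.mem := Cmd.run_mem _ _ hb
    have ρr' : ∀ y < 14, ρ'.reg y = ρ.reg y := fun y hy => Cmd.run_reg _ _ (hmods y hy)
    have hst := storeRow_spec (e := e) (σ := ρ') (h := t) fun π hπ => he π
      (fun y hy => by rw [hπ, ρr' y (by omega), ρr y (by omega) (by omega)])
      (by rw [hπ, ρr' _ (by omega), ρr _ (by omega) (by omega)])
    rw [ρr' 1 (by omega), ρr 1 (by omega) (by omega), ρr' 2 (by omega),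
      ρr 2 (by omega) (by omega), ρr' 9 (by omega), ρ9, h1, h2] at hst
    change Frame n m (i + 1) t Y ((storeRow e).run ρ') ∧
      ∀ a < fr n m t 0 0, ((storeRow e).run ρ').mem a = σ.mem a
    refine ⟨fun w hw j hj => ?_, fun a ha => ?_⟩
    · by_cases hwi : w = i
      · subst hwi
        rw [hst.1 j hj, hval j hj]
      · rw [hst.2 _ (.inl (by unfold fr; omega)), ρm]
        exact hF w (by omega) j hj
    · rw [hst.2 _ (.inl (by unfold fr at *; omega)), ρm]
      exact hlow a ha

theorem startAll_spec {k₁ k₂ s c : ℕ} (hS : Stat A L n m σ) (hO : Col n m v O σ) (hv : v < n)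
    (h3 : σ.reg 3 = v) (h4 : σ.reg 4 = k₁) (h5 : σ.reg 5 = k₂) (h6 : σ.reg 6 = s)
    (h7 : σ.reg 7 = c) :
    Frame n m (v + 1) 0 (start L O v k₁ k₂ s (c + 1)) (startAll.run σ) ∧
    ∀ a < fr n m 0 0 0, (startAll.run σ).mem a = σ.mem a := by
  refine rows_spec (body := startRow) (e := .lit 0) rfl (by decide) hS.r1 hS.r2 h3
    (fun _ _ _ => rfl) ?_
  intro ρ w hw hr h9 hm j hj
  have r1 := (hr 1 (by omega) (by omega)).trans hS.r1
  have r2 := (hr 2 (by omega) (by omega)).trans hS.r2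
  refine startRow_spec ((hr 3 (by omega) (by omega)).trans h3)
    ((hr 4 (by omega) (by omega)).trans h4) ((hr 5 (by omega) (by omega)).trans h5)
    ((hr 6 (by omega) (by omega)).trans h6) ((hr 7 (by omega) (by omega)).trans h7) h9 ?_ ?_ hj
  · intro j hj hj4
    exact (hS.congr_fr (τ := ρ) (hr 1 (by omega) (by omega)) (hr 2 (by omega) (by omega))
      hm).list w (by omega) j hj hj4
  · intro hwv
    rw [r1, r2]
    exact hO.congr (by omega) hm w (by omega)

theorem childAll_spec {h t u d : ℕ} (hS : Stat A L n m σ) (hv : v < n)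
    (hX : Frame n m (v + 1) h X σ) (ht : h < t) (hu : u < v + 1) (hd : d < 4)
    (h3 : σ.reg 3 = v) (h8 : σ.reg 8 = h) (h10 : σ.reg 10 = u) (h11 : σ.reg 11 = t)
    (h13 : σ.reg 13 = d) :
    Frame n m (v + 1) t (child A u (d + 1) X) (childAll.run σ) ∧
    ∀ a < fr n m t 0 0, (childAll.run σ).mem a = σ.mem a := by
  refine rows_spec (body := childRow) (e := .var 11) rfl (by decide) hS.r1 hS.r2 h3
    (fun ρ _ h => h.trans h11) ?_
  intro ρ w hw hr h9 hm j hj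
  have hS' := hS.congr_fr (τ := ρ) (hr 1 (by omega) (by omega)) (hr 2 (by omega) (by omega)) hm
  refine childRow_spec ((hr 8 (by omega) (by omega)).trans h8)
    ((hr 10 (by omega) (by omega)).trans h10) ((hr 13 (by omega) (by omega)).trans h13) h9
    ?_ ?_ hd hj
  · rw [hS'.r1, hS'.r2]
    exact fun j hj => hX.congr (by omega) ht hm w hw j hj
  · rw [hS'.r1, hS'.r2]
    exact hS'.adj u (by omega) w (by omega)

end Stub

/-! ### Correctness of the search -/

namespace Stub

open BL

variable {A L X : ℕ → ℕ → ℕ} {O : ℕ → ℕ} {n m v : ℕ} {σ τ : RAM.State} {H : Prop}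

/-- The states below `h` have been dealt with; if `H` holds, one of the others leads to a
colouring. -/
def Queue (A L : ℕ → ℕ → ℕ) (n m v : ℕ) (H : Prop) (h : ℕ) (σ : RAM.State) : Prop :=
  ∃ (Xs : ℕ → ℕ → ℕ → ℕ) (t : ℕ), σ.reg 11 = t ∧
    (∀ i < t, Frame n m (v + 1) i (Xs i) σ ∧ Valid A L (v + 1) (Xs i)) ∧
    h + ∑ i ∈ Finset.Ico h t, weight n (v + 1) (Xs i) ≤ (n + 2) * (n + 2) ∧
    (H → ∃ i, h ≤ i ∧ i < t ∧ Has A L (v + 1) (Xs i))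

/-- Every weight is at least 1, so the bound in `Queue` also limits the number of states ever
created. -/
theorem le_sum_weight (k a b : ℕ) (Xs : ℕ → ℕ → ℕ → ℕ) :
    b ≤ a + ∑ i ∈ Finset.Ico a b, weight n k (Xs i) := by
  have : ∑ _i ∈ Finset.Ico a b, 1 ≤ ∑ i ∈ Finset.Ico a b, weight n k (Xs i) :=
    Finset.sum_le_sum fun i _ => by unfold weight; omega
  simp only [Finset.sum_const, Nat.card_Ico, smul_eq_mul, mul_one] at this
  omega

/-- By `Valid.sum_weight` the weight of the state `h` pays 1 for its processing and the weights of
all its children. In the invariant, the sum over `g` reserves the weights of the children that are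
still to be created. -/
theorem expand_spec (hA : ∀ x y, A x y = A y x) (hS : Stat A L n m σ) (hv : v < n) {h u : ℕ}
    (hQ : Queue A L n m v H h σ) (ht : h < σ.reg 11) (h3 : σ.reg 3 = v) (h8 : σ.reg 8 = h)
    (h10 : σ.reg 10 = u) (hu : u < v + 1)
    (hbad : σ.mem (fr n m h u (σ.mem (fr n m h u 0))) = 0) :
    Queue A L n m v H (h + 1) (expand.run σ) ∧
    ∀ a < fr n m 0 0 0, (expand.run σ).mem a = σ.mem a := by
  obtain ⟨Xs, t, h11, hF, hW, hH⟩ := hQ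
  rw [h11] at ht
  obtain ⟨hFh, hVh⟩ := hF h ht
  set X := Xs h with hX
  rw [hFh u hu 0 (by omega), hFh u hu _ (by have := hVh.cur u hu; omega)] at hbad
  set g : ℕ → ℕ := fun d =>
    if X u (d + 1) = 1 then weight n (v + 1) (child A u (d + 1) X) else 0 with hg
  have key := Cmd.run_for (x := 13) (e := .lit 4)
    (p := .ifeq (.ld (eFr (.var 8) (.var 10) (plus (.var 13) 1))) (.lit 1)
      (.seq childAll (.set 11 (.sub eLim (.sub eLim (plus (.var 11) 1))))) .skip) (σ := σ)
    (fun d ρ => (∀ a < fr n m 0 0 0, ρ.mem a = σ.mem a) ∧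
      ∃ (Xs : ℕ → ℕ → ℕ → ℕ) (t : ℕ), ρ.reg 11 = t ∧ h < t ∧ Xs h = X ∧
      (∀ i < t, Frame n m (v + 1) i (Xs i) ρ ∧ Valid A L (v + 1) (Xs i)) ∧
      h + 1 + ∑ i ∈ Finset.Ico (h + 1) t, weight n (v + 1) (Xs i) + ∑ i ∈ Finset.Ico d 4, g i ≤
        (n + 2) * (n + 2) ∧
      (H → (∃ i, h + 1 ≤ i ∧ i < t ∧ Has A L (v + 1) (Xs i)) ∨
        ∃ c, d + 1 ≤ c ∧ c ≤ 4 ∧ X u c = 1 ∧ Has A L (v + 1) (child A u c X))) ?_ ?_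
  · obtain ⟨hm, Xs', t', h11', _, _, hF', hW', hH'⟩ := key
    refine ⟨⟨Xs', t', h11', hF', by simpa [Expr.eval] using hW', fun hh => ?_⟩, hm⟩
    rcases hH' hh with h' | ⟨c, h1, h2, _⟩
    · exact h'
    · simp only [Expr.eval] at h1; omega
  · refine ⟨fun _ _ => rfl, Xs, t, h11, ht, rfl, hF, ?_, fun hh => ?_⟩
    · have h1 := hVh.sum_weight (n := n) (by omega) hu hbad
      rw [Finset.sum_eq_sum_Ico_succ_bot ht, ← hX] at hW
      rw [← Finset.range_eq_Ico]
      have : ∑ d ∈ Finset.range 4, g d + 1 ≤ weight n (v + 1) X := h1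
      omega
    · obtain ⟨i, hi, hit, hhas⟩ := hH hh
      by_cases hih : i = h
      · subst hih
        obtain ⟨c, h1, h2, h3, h4⟩ := hhas.child hu
        exact .inr ⟨c, h1, h2, h3, h4⟩
      · exact .inl ⟨i, by omega, hit, hhas⟩
  · rintro d τ hd hreg ⟨hm, Xs, t, h11, ht, hXs, hF, hW, hH⟩
    have hd : d < 4 := hd
    set ρ := setR τ 13 d with hρ
    have ρ13 : ρ.reg 13 = d := by simp [hρ, setR]
    have ρ11 : ρ.reg 11 = t := by simpa [hρ, setR] using h11
    have ρr : ∀ y, y = 1 ∨ y = 2 ∨ y = 3 ∨ y = 8 ∨ y = 10 → ρ.reg y = σ.reg y := by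
      rintro y (rfl | rfl | rfl | rfl | rfl) <;>
        exact (setR_ne _ _ (by decide)).trans (hreg _ (by decide))
    have ρS : Stat A L n m ρ := hS.congr_fr (t := 0) (ρr 1 (by simp)) (ρr 2 (by simp)) hm
    have hρF : ∀ i < t, Frame n m (v + 1) i (Xs i) ρ := fun i hi => (hF i hi).1
    have hsum : ∑ i ∈ Finset.Ico d 4, g i = g d + ∑ i ∈ Finset.Ico (d + 1) 4, g i :=
      Finset.sum_eq_sum_Ico_succ_bot hd _
    have htest : (Expr.ld (eFr (.var 8) (.var 10) (plus (.var 13) 1))).eval ρ = X u (d + 1) := by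
      simp only [Expr.eval, eval_eFr, ρS.r1, ρS.r2, ρr 8 (by simp), ρr 10 (by simp), ρ13, h8, h10]
      rw [hρF h ht u hu _ (by omega), hXs]
    by_cases hbit : X u (d + 1) = 1
    · have hrun : (Cmd.ifeq (.ld (eFr (.var 8) (.var 10) (plus (.var 13) 1))) (.lit 1)
          (.seq childAll (.set 11 (.sub eLim (.sub eLim (plus (.var 11) 1))))) .skip).run ρ =
          (Cmd.set 11 (.sub eLim (.sub eLim (plus (.var 11) 1)))).run (childAll.run ρ) := by
        rw [Cmd.run_ifeq_pos (b := .lit 1) (htest.trans hbit), Cmd.run_seq]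
      rw [hrun]
      obtain ⟨cF, cm⟩ := childAll_spec ρS hv (hXs ▸ hρF h ht) ht hu hd ((ρr 3 (by simp)).trans h3)
        ((ρr 8 (by simp)).trans h8) ((ρr 10 (by simp)).trans h10) ρ11 ρ13
      set π := childAll.run ρ with hπ
      have π11 : π.reg 11 = t := (Cmd.run_reg _ _ (by decide)).trans ρ11
      have π1 : π.reg 1 = n := (Cmd.run_reg _ _ (by decide)).trans ρS.r1
      have hgd : g d = weight n (v + 1) (child A u (d + 1) X) := if_pos hbit
      -- Together with the reserve `g d ≥ 1` this gives t + 1 ≤ (n + 2)², so capping the counter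
      -- does not change it.
      have htl := le_sum_weight (n := n) (v + 1) (h + 1) t Xs
      have hpos : 1 ≤ g d := by rw [hgd]; unfold weight; omega
      refine ⟨fun a ha => ?_, Function.update Xs t (child A u (d + 1) X), t + 1, ?_, by omega,
        ?_, fun i hi => ?_, ?_, fun hh => ?_⟩
      · rw [← hm a ha]
        exact cm a (by unfold fr at *; omega)
      · simp only [Cmd.run, setR, eLim, Expr.eval, Function.update_self, π11, π1]
        omega
      · rw [Function.update_of_ne (by omega), hXs]
      · by_cases hit : i = t
        · subst hit
          rw [Function.update_self]
          exact ⟨cF, hVh.child hA hu (by omega) (by omega) hbit⟩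
        · rw [Function.update_of_ne hit]
          exact ⟨(hρF i (by omega)).congr (by omega) (show i < t by omega) cm,
            (hF i (by omega)).2⟩
      · rw [Finset.sum_Ico_succ_top (by omega), Function.update_self, ← hgd]
        have : ∑ i ∈ Finset.Ico (h + 1) t,
            weight n (v + 1) (Function.update Xs t (child A u (d + 1) X) i) =
            ∑ i ∈ Finset.Ico (h + 1) t, weight n (v + 1) (Xs i) :=
          Finset.sum_congr rfl fun i hi => by
            rw [Function.update_of_ne (by have := (Finset.mem_Ico.1 hi).2; omega)]
        rw [this]
        omega
      · rcases hH hh with ⟨i, h1, h2, h4⟩ | ⟨c, h1, h2, h4, h5⟩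
        · refine .inl ⟨i, h1, by omega, ?_⟩
          rwa [Function.update_of_ne (by omega)]
        · by_cases hcd : c = d + 1
          · subst hcd
            refine .inl ⟨t, by omega, by omega, ?_⟩
            rwa [Function.update_self]
          · exact .inr ⟨c, by omega, h2, h4, h5⟩
    · have hrun : (Cmd.ifeq (.ld (eFr (.var 8) (.var 10) (plus (.var 13) 1))) (.lit 1)
          (.seq childAll (.set 11 (.sub eLim (.sub eLim (plus (.var 11) 1))))) .skip).run ρ =
          ρ := Cmd.run_ifeq_neg (fun h => hbit (htest.symm.trans h)) _ _
      rw [hrun]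
      have hgd : g d = 0 := if_neg hbit
      refine ⟨hm, Xs, t, ρ11, ht, hXs, hF, by omega, fun hh => ?_⟩
      rcases hH hh with h' | ⟨c, h1, h2, h4, h5⟩
      · exact .inl h'
      · refine .inr ⟨c, ?_, h2, h4, h5⟩
        by_contra h6
        obtain rfl : c = d + 1 := by omega
        exact hbit h4

theorem findBad_spec (h1 : σ.reg 1 = n) (h2 : σ.reg 2 = m) (h3 : σ.reg 3 = v) {h : ℕ}
    (h8 : σ.reg 8 = h) :
    ((findBad.run σ).reg 10 = v + 1 ∧
      ∀ w < v + 1, σ.mem (fr n m h w (σ.mem (fr n m h w 0))) ≠ 0) ∨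
    ((findBad.run σ).reg 10 < v + 1 ∧
      σ.mem (fr n m h ((findBad.run σ).reg 10)
        (σ.mem (fr n m h ((findBad.run σ).reg 10) 0))) = 0) := by
  set σ' := setR σ 10 (v + 1) with hσ'
  have hr : ∀ y, y ≠ 10 → σ'.reg y = σ.reg y := fun y hy => setR_ne _ _ hy
  have hev : (plus (.var 3) 1).eval σ' = v + 1 := by simp [Expr.eval, hr 3, h3]
  have key := Cmd.run_for (x := 9) (e := plus (.var 3) 1)
    (p := .ifeq (.ld (eFr (.var 8) (.var 9) (.ld (eFr (.var 8) (.var 9) (.lit 0))))) (.lit 0)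
      (.set 10 (.var 9)) .skip) (σ := σ')
    (fun i ρ => ρ.mem = σ.mem ∧ ((ρ.reg 10 = v + 1 ∧
      ∀ w < i, σ.mem (fr n m h w (σ.mem (fr n m h w 0))) ≠ 0) ∨
      (ρ.reg 10 < v + 1 ∧
        σ.mem (fr n m h (ρ.reg 10) (σ.mem (fr n m h (ρ.reg 10) 0))) = 0))) ?_ ?_
  · rw [hev] at key
    have hrun : findBad.run σ = (Cmd.for_ 9 (plus (.var 3) 1)
        (.ifeq (.ld (eFr (.var 8) (.var 9) (.ld (eFr (.var 8) (.var 9) (.lit 0))))) (.lit 0)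
          (.set 10 (.var 9)) .skip)).run σ' := by
      rw [findBad, Cmd.run_seq, Cmd.run, Expr.eval, Expr.eval, Expr.eval, h3]
    rw [hrun]
    exact key.2
  · exact ⟨rfl, .inl ⟨setR_self _ _ _, fun w hw => absurd hw (by omega)⟩⟩
  · rintro i τ hi hreg ⟨hm, hτ⟩
    rw [hev] at hi
    have τr : ∀ y, y = 1 ∨ y = 2 ∨ y = 8 → τ.reg y = σ.reg y := by
      rintro y (rfl | rfl | rfl) <;> exact (hreg _ (by decide)).trans (hr _ (by decide))
    have e1 := (τr 1 (by simp)).trans h1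
    have e2 := (τr 2 (by simp)).trans h2
    have e8 := (τr 8 (by simp)).trans h8
    have htest : (Expr.ld (eFr (.var 8) (.var 9) (.ld (eFr (.var 8) (.var 9) (.lit 0))))).eval
        (setR τ 9 i) = σ.mem (fr n m h i (σ.mem (fr n m h i 0))) := by
      simp [Expr.eval, setR, e1, e2, e8, hm]
    by_cases hb : σ.mem (fr n m h i (σ.mem (fr n m h i 0))) = 0
    · rw [Cmd.run_ifeq_pos (b := .lit 0) (htest.trans hb)]
      refine ⟨hm, .inr ?_⟩
      simp only [Cmd.run, Expr.eval, setR_self]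
      exact ⟨hi, hb⟩
    · rw [Cmd.run_ifeq_neg (fun h => hb (htest.symm.trans h))]
      change (setR τ 9 i).mem = σ.mem ∧ (((setR τ 9 i).reg 10 = v + 1 ∧ _) ∨
        ((setR τ 9 i).reg 10 < v + 1 ∧ σ.mem (fr n m h ((setR τ 9 i).reg 10)
          (σ.mem (fr n m h ((setR τ 9 i).reg 10) 0))) = 0))
      have h10 : (setR τ 9 i).reg 10 = τ.reg 10 := setR_ne _ _ (by decide)
      refine ⟨hm, ?_⟩
      rw [h10]
      rcases hτ with ⟨h4, h5⟩ | h4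
      · refine .inl ⟨h4, fun w hw => ?_⟩
        by_cases hwi : w = i
        · subst hwi; exact hb
        · exact h5 w (by omega)
      · exact .inr h4

/-- The stored colouring lies below all states, so copying into it does not disturb the state being
read. -/
theorem accept_spec (h1 : σ.reg 1 = n) (h2 : σ.reg 2 = m) (h3 : σ.reg 3 = v) (hv : v < n) {h : ℕ}
    (h8 : σ.reg 8 = h) (hX : Frame n m (v + 1) h X σ) :
    (accept.run σ).reg 12 = 1 ∧ Col n m (v + 1) (fun w => X w 0) (accept.run σ) ∧
    ∀ a < baseO n m, (accept.run σ).mem a = σ.mem a := by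
  set σ' := setR σ 12 1 with hσ'
  have hr : ∀ y, y ≠ 12 → σ'.reg y = σ.reg y := fun y hy => setR_ne _ _ hy
  have hev : (plus (.var 3) 1).eval σ' = v + 1 := by simp [Expr.eval, hr 3, h3]
  have key := Cmd.run_for (x := 9) (e := plus (.var 3) 1)
    (p := .sto (eCol (.var 9)) (.ld (eFr (.var 8) (.var 9) (.lit 0)))) (σ := σ')
    (fun i ρ => Frame n m (v + 1) h X ρ ∧ Col n m i (fun w => X w 0) ρ ∧
      ∀ a < baseO n m, ρ.mem a = σ.mem a) ?_ ?_
  · rw [hev] at key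
    refine ⟨?_, key.2⟩
    exact (Cmd.run_reg _ σ' (by decide)).trans (setR_self _ _ _)
  · exact ⟨hX, fun w hw => absurd hw (by omega), fun _ _ => rfl⟩
  · rintro i τ hi hreg ⟨hF, hC, hm⟩
    rw [hev] at hi
    have τr : ∀ y, y = 1 ∨ y = 2 ∨ y = 8 → τ.reg y = σ.reg y := by
      rintro y (rfl | rfl | rfl) <;> exact (hreg _ (by decide)).trans (hr _ (by decide))
    have e1 := (τr 1 (by simp)).trans h1
    have e2 := (τr 2 (by simp)).trans h2
    have e8 := (τr 8 (by simp)).trans h8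
    have hmem : ((Cmd.sto (eCol (.var 9)) (.ld (eFr (.var 8) (.var 9) (.lit 0)))).run
        (setR τ 9 i)).mem = Function.update τ.mem (baseO n m + i) (X i 0) := by
      simp only [Cmd.run, setM, Expr.eval, eval_eFr, eval_eCol, setR, ne_eq, Nat.reduceEqDiff,
        not_false_eq_true, Function.update_of_ne, Function.update_self, e1, e2, e8,
        OfNat.one_ne_ofNat]
      rw [hF i hi 0 (by omega)]
    refine ⟨fun w hw j hj => ?_, fun w hw => ?_, fun a ha => ?_⟩
    · rw [hmem, Function.update_of_ne (by unfold fr; omega)]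
      exact hF w hw j hj
    · rw [hmem]
      by_cases hwi : w = i
      · subst hwi; exact Function.update_self _ _ _
      · rw [Function.update_of_ne (by omega)]
        exact hC w (by omega)
    · rw [hmem, Function.update_of_ne (by omega)]
      exact hm a ha

/-- A colouring of the first `v + 1` vertices has been found. -/
def Found (A L : ℕ → ℕ → ℕ) (n m v : ℕ) (σ : RAM.State) : Prop :=
  σ.reg 12 = 1 ∧ ∃ O, Col n m (v + 1) O σ ∧ Sol A L (v + 1) O

theorem process_spec (hA : ∀ x y, A x y = A y x) (hS : Stat A L n m σ) (hv : v < n) {h : ℕ}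
    (hO : Col n m v O σ) (hQ : Queue A L n m v H h σ) (ht : h < σ.reg 11) (h3 : σ.reg 3 = v)
    (h8 : σ.reg 8 = h) (h12 : σ.reg 12 = 0) :
    Stat A L n m (process.run σ) ∧ (Found A L n m v (process.run σ) ∨
      (process.run σ).reg 12 = 0 ∧ Col n m v O (process.run σ) ∧
        Queue A L n m v H (h + 1) (process.run σ)) := by
  set ρ := findBad.run σ with hρ
  have ρm : ρ.mem = σ.mem := Cmd.run_mem _ _ rfl
  have ρr : ∀ y, y = 1 ∨ y = 2 ∨ y = 3 ∨ y = 8 ∨ y = 11 ∨ y = 12 → ρ.reg y = σ.reg y := by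
    rintro y (rfl | rfl | rfl | rfl | rfl | rfl) <;> exact Cmd.run_reg _ _ (by decide)
  have ρS : Stat A L n m ρ := hS.congr (ρr 1 (by simp)) (ρr 2 (by simp)) fun a _ => by rw [ρm]
  have ρ3 : ρ.reg 3 = v := (ρr 3 (by simp)).trans h3
  have ρ8 : ρ.reg 8 = h := (ρr 8 (by simp)).trans h8
  have hcase := findBad_spec hS.r1 hS.r2 h3 h8
  rw [← hρ] at hcase
  have hev : (plus (.var 3) 1).eval ρ = v + 1 := by simp [Expr.eval, ρ3]
  have hQ' := hQ
  obtain ⟨Xs, t, h11, hF, hW, hH⟩ := hQ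
  rw [h11] at ht
  obtain ⟨hFh, hVh⟩ := hF h ht
  rcases hcase with ⟨h10, hgood⟩ | ⟨h10, hbad⟩
  · have hrun : process.run σ = accept.run ρ := by
      rw [process, Cmd.run_seq, ← hρ, Cmd.run_ifeq_pos (by rw [hev]; exact h10)]
    rw [hrun]
    obtain ⟨a1, a2, a3⟩ := accept_spec ρS.r1 ρS.r2 ρ3 hv ρ8
      (show Frame n m (v + 1) h (Xs h) ρ from fun w hw j hj => by rw [ρm]; exact hFh w hw j hj)
    refine ⟨ρS.congr (Cmd.run_reg _ _ (by decide)) (Cmd.run_reg _ _ (by decide)) a3,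
      .inl ⟨a1, _, a2, hVh.sol fun w hw => ?_⟩⟩
    have := hgood w hw
    rwa [hFh w hw 0 (by omega), hFh w hw _ (by have := hVh.cur w hw; omega)] at this
  · have hrun : process.run σ = expand.run ρ := by
      rw [process, Cmd.run_seq, ← hρ,
        Cmd.run_ifeq_neg (by rw [hev]; simp only [Expr.eval]; omega)]
    rw [hrun]
    have ρQ : Queue A L n m v H h ρ :=
      ⟨Xs, t, (ρr 11 (by simp)).trans h11, fun i hi =>
        ⟨fun w hw j hj => by rw [ρm]; exact (hF i hi).1 w hw j hj, (hF i hi).2⟩, hW, hH⟩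
    obtain ⟨a1, a2⟩ := expand_spec hA ρS hv ρQ (by rw [ρr 11 (by simp), h11]; exact ht) ρ3 ρ8 rfl
      h10 (by rw [ρm]; exact hbad)
    have hm : ∀ a < fr n m 0 0 0, (expand.run ρ).mem a = σ.mem a := fun a ha => by
      rw [a2 a ha, ρm]
    exact ⟨ρS.congr_fr (Cmd.run_reg _ _ (by decide)) (Cmd.run_reg _ _ (by decide)) a2,
      .inr ⟨((Cmd.run_reg _ _ (by decide)).trans (ρr 12 (by simp))).trans h12,
        hO.congr (by omega) hm, a1⟩⟩

/-- If nothing has been found after (n + 2)² rounds, the bound in `Queue` shows that no state is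
pending. As a pending state would have to carry any existing colouring, there is none. -/
theorem search_spec (hA : ∀ x y, A x y = A y x) (hS : Stat A L n m σ) (hv : v < n)
    (hO : Col n m v O σ) (hX : Frame n m (v + 1) 0 X σ) (hV : Valid A L (v + 1) X)
    (h3 : σ.reg 3 = v) (h12 : σ.reg 12 = 0) :
    Stat A L n m (search.run σ) ∧ (Found A L n m v (search.run σ) ∨
      (search.run σ).reg 12 = 0 ∧ Col n m v O (search.run σ) ∧ ¬ Has A L (v + 1) X) := by
  set σ' := setR σ 11 1 with hσ'
  have hr : ∀ y, y ≠ 11 → σ'.reg y = σ.reg y := fun y hy => setR_ne _ _ hy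
  have hev : eLim.eval σ' = (n + 2) * (n + 2) := by
    simp [eLim, Expr.eval, hr 1, hS.r1]
  have key := Cmd.run_for (x := 8) (e := eLim) (p := .iflt (.var 8) (.var 11)
      (.ifeq (.var 12) (.lit 0) process .skip) .skip) (σ := σ')
    (fun i ρ => Stat A L n m ρ ∧ (Found A L n m v ρ ∨
      ρ.reg 12 = 0 ∧ Col n m v O ρ ∧ Queue A L n m v (Has A L (v + 1) X) i ρ)) ?_ ?_
  · rw [hev] at key
    change Stat A L n m (search.run σ) ∧ (Found A L n m v (search.run σ) ∨
      (search.run σ).reg 12 = 0 ∧ Col n m v O (search.run σ) ∧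
        Queue A L n m v (Has A L (v + 1) X) ((n + 2) * (n + 2)) (search.run σ)) at key
    refine ⟨key.1, key.2.imp_right fun ⟨a1, a2, a3⟩ => ⟨a1, a2, fun hh => ?_⟩⟩
    obtain ⟨Xs, t, _, _, hW, hH⟩ := a3
    obtain ⟨i, h1, h2, _⟩ := hH hh
    have := le_sum_weight (n := n) (v + 1) ((n + 2) * (n + 2)) t Xs
    omega
  · refine ⟨hS.congr (hr 1 (by decide)) (hr 2 (by decide)) fun _ _ => rfl,
      .inr ⟨(hr 12 (by decide)).trans h12, hO, fun _ => X, 1, setR_self _ _ _,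
        fun i hi => ?_, ?_, fun hh => ⟨0, le_rfl, by omega, hh⟩⟩⟩
    · obtain rfl : i = 0 := by omega
      exact ⟨hX, hV⟩
    · simpa using weight_le (X := X) (show v + 1 ≤ n by omega)
  · rintro i τ hi hreg ⟨τS, hτ⟩
    rw [hev] at hi
    set ρ := setR τ 8 i with hρ
    have ρr : ∀ y, y ≠ 8 → ρ.reg y = τ.reg y := fun y hy => setR_ne _ _ hy
    have ρ8 : ρ.reg 8 = i := setR_self _ _ _
    have ρ3 : ρ.reg 3 = v := by
      rw [ρr 3 (by decide), hreg 3 (by decide), hr 3 (by decide), h3]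
    have ρS : Stat A L n m ρ := τS.congr (ρr 1 (by decide)) (ρr 2 (by decide)) fun _ _ => rfl
    have e8 : (Expr.var 8).eval ρ = i := ρ8
    have e11 : (Expr.var 11).eval ρ = τ.reg 11 := ρr 11 (by decide)
    have e12 : (Expr.var 12).eval ρ = τ.reg 12 := ρr 12 (by decide)
    rcases hτ with hτ | ⟨τ12, τO, τQ⟩
    · have hF : Found A L n m v ρ := ⟨e12.trans hτ.1, hτ.2⟩
      have hrun : (Cmd.iflt (.var 8) (.var 11)
          (.ifeq (.var 12) (.lit 0) process .skip) .skip).run ρ = ρ := by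
        by_cases hlt : (Expr.var 8).eval ρ < (Expr.var 11).eval ρ
        · rw [Cmd.run_iflt_pos hlt, Cmd.run_ifeq_neg]
          · rfl
          · rw [e12, hτ.1]; exact one_ne_zero
        · rw [Cmd.run_iflt_neg hlt]
          rfl
      rw [hrun]
      exact ⟨ρS, .inl hF⟩
    · obtain ⟨Xs, t, h11, hF, hW, hH⟩ := τQ
      have ρQ : Queue A L n m v (Has A L (v + 1) X) i ρ :=
        ⟨Xs, t, (ρr 11 (by decide)).trans h11, hF, hW, hH⟩
      by_cases hit : i < t
      · rw [Cmd.run_iflt_pos (by rw [e8, e11, h11]; exact hit),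
          Cmd.run_ifeq_pos (b := .lit 0) (e12.trans τ12)]
        exact process_spec hA ρS hv τO ρQ (by rw [ρr 11 (by decide), h11]; exact hit) ρ3 ρ8
          ((ρr 12 (by decide)).trans τ12)
      · rw [Cmd.run_iflt_neg (by rw [e8, e11, h11]; exact hit)]
        refine ⟨ρS, .inr ⟨(ρr 12 (by decide)).trans τ12, τO, Xs, t,
          (ρr 11 (by decide)).trans h11, hF, ?_, fun hh => ?_⟩⟩
        -- An idle round: nothing is pending, so the sum is empty.
        · rw [Finset.Ico_eq_empty (by omega)]; simpa using hi
        · obtain ⟨j, h1, h2, _⟩ := hH hh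
          omega

/-! ### The loops over the guesses and over the vertices -/

/-- Either a colouring has been found, or the colouring `O` of the first `v` vertices is still
there. -/
structure Base (A L : ℕ → ℕ → ℕ) (n m v : ℕ) (O : ℕ → ℕ) (σ : RAM.State) : Prop where
  stat : Stat A L n m σ
  r3 : σ.reg 3 = v
  col : Found A L n m v σ ∨ σ.reg 12 = 0 ∧ Col n m v O σ

theorem Base.setR (h : Base A L n m v O σ) {x i : ℕ} (h1 : x ≠ 1) (h2 : x ≠ 2) (h3 : x ≠ 3)
    (h12 : x ≠ 12) : Base A L n m v O (setR σ x i) := by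
  have hr : ∀ y, y ≠ x → (BL.setR σ x i).reg y = σ.reg y := fun y hy =>
    setR_ne _ _ hy
  refine ⟨h.stat.congr (hr 1 h1.symm) (hr 2 h2.symm) fun _ _ => rfl, (hr 3 h3.symm).trans h.r3, ?_⟩
  rcases h.col with hc | hc
  · exact .inl ⟨(hr 12 h12.symm).trans hc.1, hc.2⟩
  · exact .inr ⟨(hr 12 h12.symm).trans hc.1, hc.2⟩

theorem trySeeds_spec (hA : ∀ x y, A x y = A y x) (hL : ∀ w < n, ∀ j, L w j = 0 ∨ L w j = 1)
    (hL3 : ∀ w < n, L w 3 = 1 → L w 1 = 0) (hv : v < n) (hO : Sol A L v O)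
    (hB : Base A L n m v O σ) :
    Base A L n m v O (trySeeds.run σ) ∧ ((trySeeds.run σ).reg 12 = 0 → σ.reg 12 = 0 ∧
      ¬ Has A L (v + 1) (start L O v (σ.reg 4) (σ.reg 5) (σ.reg 6) (σ.reg 7 + 1))) := by
  rcases hB.col with hc | ⟨h12, hc⟩
  · have hrun : trySeeds.run σ = σ :=
      Cmd.run_ifeq_neg (a := .var 12) (b := .lit 0) (show σ.reg 12 ≠ 0 by rw [hc.1]; exact one_ne_zero) _ _
    rw [hrun]
    exact ⟨hB, fun h => absurd h (by rw [hc.1]; omega)⟩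
  · have hrun : trySeeds.run σ = search.run (startAll.run σ) :=
      Cmd.run_ifeq_pos (a := .var 12) (b := .lit 0) h12 _ _
    rw [hrun]
    obtain ⟨hF, hm⟩ := startAll_spec hB.stat hc hv hB.r3 rfl rfl rfl rfl
    set ρ := startAll.run σ with hρ
    have ρr : ∀ y, y = 1 ∨ y = 2 ∨ y = 3 ∨ y = 12 → ρ.reg y = σ.reg y := by
      rintro y (rfl | rfl | rfl | rfl) <;> exact Cmd.run_reg _ _ (by decide)
    have ρ3 := (ρr 3 (by simp)).trans hB.r3
    obtain ⟨hS, hres⟩ := search_spec hA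
      (hB.stat.congr_fr (ρr 1 (by simp)) (ρr 2 (by simp)) hm) hv (hc.congr (by omega) hm) hF
      (start_valid (fun w hw => hL w (by omega)) (fun w hw => hL3 w (by omega)) hO (by omega))
      ρ3 ((ρr 12 (by simp)).trans h12)
    refine ⟨⟨hS, (Cmd.run_reg _ _ (by decide)).trans ρ3, hres.imp_right fun h => ⟨h.1, h.2.1⟩⟩,
      fun h0 => ⟨h12, ?_⟩⟩
    rcases hres with h | h
    · exact absurd h.1 (by omega)
    · exact h.2.2

/-- The common rule for the four nested guessing loops. A round never resets variable 12 to 0, so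
the value 0 at the end means that every round has failed. -/
theorem tries_spec {x b : ℕ} {e : Expr} {p : Cmd} {P : ℕ → Prop} (he : e.eval σ = b)
    (hx : x ≠ 1 ∧ x ≠ 2 ∧ x ≠ 3 ∧ x ≠ 12) (hB : Base A L n m v O σ)
    (hp : ∀ i < b, ∀ τ, Base A L n m v O τ →
      (∀ y, y ≠ x → y ∉ p.mods → τ.reg y = σ.reg y) → τ.reg x = i →
      Base A L n m v O (p.run τ) ∧ ((p.run τ).reg 12 = 0 → τ.reg 12 = 0 ∧ P i)) :
    Base A L n m v O ((Cmd.for_ x e p).run σ) ∧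
      (((Cmd.for_ x e p).run σ).reg 12 = 0 → σ.reg 12 = 0 ∧ ∀ i < b, P i) := by
  subst he
  refine Cmd.run_for (fun i ρ => Base A L n m v O ρ ∧
    (ρ.reg 12 = 0 → σ.reg 12 = 0 ∧ ∀ j < i, P j)) ⟨hB, fun h => ⟨h, fun j hj => absurd hj (by omega)⟩⟩
    ?_
  rintro i τ hi hreg ⟨hτ, h0⟩
  obtain ⟨h1, h2⟩ := hp i hi (setR τ x i) (hτ.setR hx.1 hx.2.1 hx.2.2.1 hx.2.2.2)
    (fun y hy hy' => (setR_ne _ _ hy).trans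
      (hreg y (by simp only [Cmd.mods, List.mem_cons, not_or]; exact ⟨hy, hy'⟩)))
    (setR_self _ _ _)
  refine ⟨h1, fun h => ?_⟩
  obtain ⟨h3, h4⟩ := h2 h
  have h5 : τ.reg 12 = 0 := by
    rw [← h3]; exact (setR_ne _ _ hx.2.2.2.symm).symm
  refine ⟨(h0 h5).1, fun j hj => ?_⟩
  by_cases hji : j = i
  · subst hji; exact h4
  · exact (h0 h5).2 j (by omega)

theorem tryAll_spec (hA : ∀ x y, A x y = A y x) (hL : ∀ w < n, ∀ j, L w j = 0 ∨ L w j = 1)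
    (hL3 : ∀ w < n, L w 3 = 1 → L w 1 = 0) (hv : v < n) (hO : Sol A L v O)
    (hB : Base A L n m v O σ) :
    Base A L n m v O (tryAll.run σ) ∧ ((tryAll.run σ).reg 12 = 0 →
      ∀ k₁ < v + 1, ∀ k₂ < v + 1, ∀ s < v + 1, ∀ c < 4,
        ¬ Has A L (v + 1) (start L O v k₁ k₂ s (c + 1))) := by
  have hev : ∀ τ, Base A L n m v O τ → (plus (.var 3) 1).eval τ = v + 1 := fun τ h => by
    simp [Expr.eval, h.r3]
  have key := tries_spec (x := 4) (e := plus (.var 3) 1)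
    (p := .for_ 5 (plus (.var 3) 1) (.for_ 6 (plus (.var 3) 1) (.for_ 7 (.lit 4) trySeeds)))
    (P := fun k₁ => ∀ k₂ < v + 1, ∀ s < v + 1, ∀ c < 4,
      ¬ Has A L (v + 1) (start L O v k₁ k₂ s (c + 1))) (hev σ hB) (by decide) hB ?_
  · exact ⟨key.1, fun h => (key.2 h).2⟩
  intro k₁ _ τ₁ hB₁ _ h4
  refine tries_spec (x := 5) (e := plus (.var 3) 1)
    (p := .for_ 6 (plus (.var 3) 1) (.for_ 7 (.lit 4) trySeeds))
    (P := fun k₂ => ∀ s < v + 1, ∀ c < 4,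
      ¬ Has A L (v + 1) (start L O v k₁ k₂ s (c + 1))) (hev τ₁ hB₁) (by decide) hB₁ ?_
  intro k₂ _ τ₂ hB₂ hr₂ h5
  refine tries_spec (x := 6) (e := plus (.var 3) 1) (p := .for_ 7 (.lit 4) trySeeds)
    (P := fun s => ∀ c < 4, ¬ Has A L (v + 1) (start L O v k₁ k₂ s (c + 1)))
    (hev τ₂ hB₂) (by decide) hB₂ ?_
  intro s _ τ₃ hB₃ hr₃ h6
  refine tries_spec (x := 7) (e := .lit 4) (p := trySeeds)
    (P := fun c => ¬ Has A L (v + 1) (start L O v k₁ k₂ s (c + 1))) rfl (by decide) hB₃ ?_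
  intro c _ τ₄ hB₄ hr₄ h7
  have := trySeeds_spec hA hL hL3 hv hO hB₄
  rw [h7, hr₄ 6 (by decide) (by decide), h6, hr₄ 5 (by decide) (by decide),
    hr₃ 5 (by decide) (by decide), h5, hr₄ 4 (by decide) (by decide),
    hr₃ 4 (by decide) (by decide), hr₂ 4 (by decide) (by decide), h4] at this
  exact this

theorem Sol.mono {k k' : ℕ} {N : ℕ → ℕ} (h : Sol A L k' N) (hk : k ≤ k') : Sol A L k N :=
  ⟨fun u hu => h.1 u (by omega), fun u hu w hw => h.2 u (by omega) w (by omega)⟩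

theorem stage_spec (hA : ∀ x y, A x y = A y x) (hL : ∀ w < n, ∀ j, L w j = 0 ∨ L w j = 1)
    (hL3 : ∀ w < n, L w 3 = 1 → L w 1 = 0) (hv : v < n) (hO : Sol A L v O)
    (hS : Stat A L n m σ) (hC : Col n m v O σ) (h3 : σ.reg 3 = v) (h0 : σ.reg 0 = 1) :
    Stat A L n m (stage.run σ) ∧
    (((stage.run σ).reg 0 = 1 ∧ ∃ O', Col n m (v + 1) O' (stage.run σ) ∧ Sol A L (v + 1) O') ∨
      (stage.run σ).reg 0 = 0 ∧ ¬ ∃ N, Sol A L (v + 1) N) := by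
  set σ' := setR σ 12 0 with hσ'
  have hr : ∀ y, y ≠ 12 → σ'.reg y = σ.reg y := fun y hy => setR_ne _ _ hy
  have hB : Base A L n m v O σ' :=
    ⟨hS.congr (hr 1 (by decide)) (hr 2 (by decide)) fun _ _ => rfl, (hr 3 (by decide)).trans h3,
      .inr ⟨setR_self _ _ _, hC⟩⟩
  obtain ⟨hB', hres⟩ := tryAll_spec hA hL hL3 hv hO hB
  set ρ := tryAll.run σ' with hρ
  have ρ0 : ρ.reg 0 = 1 := by
    rw [← h0, ← hr 0 (by decide)]; exact Cmd.run_reg _ _ (by decide)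
  have hrun₀ : stage.run σ = (Cmd.ifeq (.var 12) (.lit 0) (.set 0 (.lit 0)) .skip).run ρ := by
    rw [stage, Cmd.run_seq, Cmd.run_seq]
    rfl
  rcases hB'.col with hF | ⟨h12, _⟩
  · have hrun : stage.run σ = ρ := by
      rw [hrun₀]
      exact Cmd.run_ifeq_neg (a := .var 12) (b := .lit 0)
        (show ρ.reg 12 ≠ 0 by rw [hF.1]; exact one_ne_zero) _ _
    rw [hrun]
    exact ⟨hB'.stat, .inl ⟨ρ0, hF.2⟩⟩
  · have hrun : stage.run σ = setR ρ 0 0 := by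
      rw [hrun₀]
      exact Cmd.run_ifeq_pos (a := .var 12) (b := .lit 0) h12 _ _
    rw [hrun]
    refine ⟨hB'.stat.congr (setR_ne _ _ (by decide))
      (setR_ne _ _ (by decide)) fun _ _ => rfl,
      .inr ⟨setR_self _ _ _, ?_⟩⟩
    rintro ⟨N, hN⟩
    obtain ⟨k₁, a1, k₂, a2, s, a3, c, a4, hh⟩ := Has.sol_of_start hO hN
    exact hres h12 k₁ (by omega) k₂ (by omega) s (by omega) c a4 hh

/-- A failure at any stage is final, since feasible colourings restrict to initial segments of the
vertices (`Sol.mono`). -/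
theorem solve_spec (hA : ∀ x y, A x y = A y x) (hL : ∀ w < n, ∀ j, L w j = 0 ∨ L w j = 1)
    (hL3 : ∀ w < n, L w 3 = 1 → L w 1 = 0) (hS : Stat A L n m σ) (h0 : σ.reg 0 = 1) :
    ((∃ N, Sol A L n N) → (solve.run σ).reg 0 = 1) ∧
    ((¬ ∃ N, Sol A L n N) → (solve.run σ).reg 0 = 0) := by
  have key := Cmd.run_for (x := 3) (e := .var 1) (p := .ifeq (.var 0) (.lit 1) stage .skip)
    (σ := σ) (fun i ρ => Stat A L n m ρ ∧
      ((ρ.reg 0 = 1 ∧ ∃ O, Col n m i O ρ ∧ Sol A L i O) ∨ ρ.reg 0 = 0 ∧ ¬ ∃ N, Sol A L n N)) ?_ ?_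
  · have hev : (Expr.var 1).eval σ = n := hS.r1
    rw [hev] at key
    change Stat A L n m (solve.run σ) ∧ (((solve.run σ).reg 0 = 1 ∧
      ∃ O, Col n m n O (solve.run σ) ∧ Sol A L n O) ∨ (solve.run σ).reg 0 = 0 ∧
      ¬ ∃ N, Sol A L n N) at key
    rcases key.2 with ⟨h1, O, _, hO⟩ | ⟨h1, h2⟩
    · exact ⟨fun _ => h1, fun h => absurd ⟨O, hO⟩ h⟩
    · exact ⟨fun h => absurd h h2, fun _ => h1⟩
  · exact ⟨hS, .inl ⟨h0, fun _ => 0, fun w hw => absurd hw (by omega),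
      fun w hw => absurd hw (by omega), fun w hw => absurd hw (by omega)⟩⟩
  · rintro i τ hi _ ⟨τS, hτ⟩
    have hi : i < n := by rw [← hS.r1]; exact hi
    set ρ := setR τ 3 i with hρ
    have ρr : ∀ y, y ≠ 3 → ρ.reg y = τ.reg y := fun y hy => setR_ne _ _ hy
    have ρS : Stat A L n m ρ := τS.congr (ρr 1 (by decide)) (ρr 2 (by decide)) fun _ _ => rfl
    rcases hτ with ⟨h1, O, hC, hO⟩ | ⟨h1, h2⟩
    · have ρ0 := (ρr 0 (by decide)).trans h1
      rw [Cmd.run_ifeq_pos (show (Expr.var 0).eval ρ = (Expr.lit 1).eval ρ from ρ0)]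
      obtain ⟨a1, a2⟩ := stage_spec hA hL hL3 hi hO ρS hC (setR_self _ _ _) ρ0
      refine ⟨a1, a2.imp_right fun h => ⟨h.1, fun ⟨N, hN⟩ => h.2 ⟨N, hN.mono (by omega)⟩⟩⟩
    · have ρ0 := (ρr 0 (by decide)).trans h1
      rw [Cmd.run_ifeq_neg (a := .var 0) (b := .lit 1) (show ρ.reg 0 ≠ 1 by omega)]
      exact ⟨ρS, .inr ⟨ρ0, h2⟩⟩

end Stub

/-! ### The preparations -/

namespace Stub

open BL

variable {A L : ℕ → ℕ → ℕ} {n m : ℕ} {σ : RAM.State}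

/-- The colour `1` is removed from the lists that contain the colour `3`. -/
def drop (L : ℕ → ℕ → ℕ) (w j : ℕ) : ℕ := if j = 1 ∧ L w 3 = 1 then 0 else L w j

theorem dropOne_spec (h1 : σ.reg 1 = n)
    (hL : ∀ w < n, ∀ j, 1 ≤ j → j ≤ 4 → σ.mem (1 + 4 * w + j) = L w j) :
    (∀ w < n, ∀ j, 1 ≤ j → j ≤ 4 → (dropOne.run σ).mem (1 + 4 * w + j) = drop L w j) ∧
    ∀ a, 2 + 4 * n ≤ a → (dropOne.run σ).mem a = σ.mem a := by
  have hev : (Expr.var 1).eval σ = n := h1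
  have key := Cmd.run_for (x := 9) (e := .var 1)
    (p := .ifeq (.ld (eList (.var 9) 3)) (.lit 1) (.sto (eList (.var 9) 1) (.lit 0)) .skip) (σ := σ)
    (fun i ρ => (∀ w < n, ∀ j, 1 ≤ j → j ≤ 4 →
      ρ.mem (1 + 4 * w + j) = if w < i then drop L w j else L w j) ∧
      ∀ a, 2 + 4 * n ≤ a → ρ.mem a = σ.mem a) ?_ ?_
  · rw [hev] at key
    refine ⟨fun w hw j hj hj4 => ?_, key.2⟩
    have := key.1 w hw j hj hj4
    rwa [if_pos hw] at this
  · exact ⟨by simpa using hL, fun _ _ => rfl⟩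
  · rintro i τ hi _ ⟨h2, h3⟩
    rw [hev] at hi
    have e9 : (setR τ 9 i).reg 9 = i := setR_self _ _ _
    have htest : (Expr.ld (eList (.var 9) 3)).eval (setR τ 9 i) = L i 3 := by
      have := h2 i hi 3 (by omega) (by omega)
      rw [if_neg (lt_irrefl i)] at this
      rw [← this]
      simp only [Expr.eval, eval_eList, e9]
      rfl
    by_cases h : L i 3 = 1
    · rw [Cmd.run_ifeq_pos (b := .lit 1) (htest.trans h)]
      have hm : ((Cmd.sto (eList (.var 9) 1) (.lit 0)).run (setR τ 9 i)).mem =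
          Function.update τ.mem (1 + 4 * i + 1) 0 := by
        simp only [Cmd.run, setM, eval_eList, Expr.eval, e9]
        rfl
      rw [hm]
      refine ⟨fun w hw j hj hj4 => ?_, fun a ha => ?_⟩
      · by_cases hwj : w = i ∧ j = 1
        · rw [hwj.1, hwj.2, Function.update_self, if_pos (by omega)]
          simp [drop, h]
        · rw [Function.update_of_ne (by omega), h2 w hw j hj hj4]
          by_cases hwi : w = i
          · subst hwi
            rw [if_neg (lt_irrefl w), if_pos (by omega), drop, if_neg (by omega)]
          · by_cases hlt : w < i
            · rw [if_pos hlt, if_pos (by omega)]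
            · rw [if_neg hlt, if_neg (by omega)]
      · rw [Function.update_of_ne (by omega)]
        exact h3 a ha
    · rw [Cmd.run_ifeq_neg (b := .lit 1) (fun h' => h (htest.symm.trans h'))]
      refine ⟨fun w hw j hj hj4 => ?_, h3⟩
      have := h2 w hw j hj hj4
      change τ.mem _ = _
      rw [this]
      by_cases hwi : w = i
      · subst hwi
        rw [if_neg (lt_irrefl w), if_pos (by omega), drop, if_neg (fun h' => h h'.2)]
      · by_cases hlt : w < i
        · rw [if_pos hlt, if_pos (by omega)]
        · rw [if_neg hlt, if_neg (by omega)]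

theorem mul_add_inj {u u' w w' : ℕ} (hw : w < n) (hw' : w' < n) (h : n * u + w = n * u' + w') :
    u = u' ∧ w = w' := by
  have hu : u = u' := by
    have h1 := Nat.mul_add_div (show 0 < n by omega) u w
    have h2 := Nat.mul_add_div (show 0 < n by omega) u' w'
    rw [Nat.div_eq_of_lt hw] at h1
    rw [Nat.div_eq_of_lt hw'] at h2
    rw [h, h2] at h1
    omega
  subst hu
  exact ⟨rfl, by omega⟩

open Classical in
/-- The adjacency matrix of the first `i` edges. -/
noncomputable def matrix (x y : ℕ → ℕ) (i u w : ℕ) : ℕ :=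
  if ∃ e < i, (x e = u ∧ y e = w) ∨ (x e = w ∧ y e = u) then 1 else 0

theorem matrix_symm (x y : ℕ → ℕ) (i u w : ℕ) : matrix x y i u w = matrix x y i w u := by
  unfold matrix
  simp only [or_comm]

theorem matrix_succ (x y : ℕ → ℕ) (i u w : ℕ) : matrix x y (i + 1) u w =
    if (x i = u ∧ y i = w) ∨ (x i = w ∧ y i = u) then 1 else matrix x y i u w := by
  unfold matrix
  by_cases h : (x i = u ∧ y i = w) ∨ (x i = w ∧ y i = u)
  · rw [if_pos h, if_pos ⟨i, by omega, h⟩]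
  · rw [if_neg h]
    congr 1
    refine propext ⟨fun ⟨e, he, h'⟩ => ⟨e, ?_, h'⟩, fun ⟨e, he, h'⟩ => ⟨e, by omega, h'⟩⟩
    by_contra hei
    obtain rfl : e = i := by omega
    exact h h'

theorem readEdges_spec {x y : ℕ → ℕ} (h1 : σ.reg 1 = n) (h2 : σ.reg 2 = m)
    (hx : ∀ e < m, σ.mem (2 + 4 * n + 2 * e) = x e ∧ x e < n)
    (hy : ∀ e < m, σ.mem (2 + 4 * n + 2 * e + 1) = y e ∧ y e < n)
    (h0 : ∀ a, baseA n m ≤ a → σ.mem a = 0) :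
    (∀ u < n, ∀ w < n, (readEdges.run σ).mem (baseA n m + (n * u + w)) = matrix x y m u w) ∧
    ∀ a < baseA n m, (readEdges.run σ).mem a = σ.mem a := by
  have hev : (Expr.var 2).eval σ = m := h2
  have key := Cmd.run_for (x := 9) (e := .var 2)
    (p := .seq (.set 15 (eEdge 0)) (.seq (.set 16 (eEdge 1))
      (.seq (.sto (eAdj (.var 15) (.var 16)) (.lit 1)) (.sto (eAdj (.var 16) (.var 15)) (.lit 1)))))
    (σ := σ)
    (fun i ρ => (∀ u < n, ∀ w < n, ρ.mem (baseA n m + (n * u + w)) = matrix x y i u w) ∧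
      ∀ a < baseA n m, ρ.mem a = σ.mem a) ?_ ?_
  · rw [hev] at key
    exact key
  -- The memory beyond the input is 0, which is already the adjacency matrix of the edgeless graph.
  · exact ⟨fun u _ w _ => by simp [h0, matrix], fun _ _ => rfl⟩
  · rintro i τ hi hreg ⟨h3, h4⟩
    rw [hev] at hi
    have t1 : τ.reg 1 = n := (hreg 1 (by decide)).trans h1
    have t2 : τ.reg 2 = m := (hreg 2 (by decide)).trans h2
    obtain ⟨hxi, hxn⟩ := hx i hi
    obtain ⟨hyi, hyn⟩ := hy i hi
    rw [← h4 _ (by unfold baseA; omega)] at hxi hyi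
    have hm : ((Cmd.seq (.set 15 (eEdge 0)) (.seq (.set 16 (eEdge 1))
        (.seq (.sto (eAdj (.var 15) (.var 16)) (.lit 1))
          (.sto (eAdj (.var 16) (.var 15)) (.lit 1))))).run (setR τ 9 i)).mem =
        Function.update (Function.update τ.mem (baseA n m + (n * x i + y i)) 1)
          (baseA n m + (n * y i + x i)) 1 := by
      simp [Cmd.run, setM, setR, eEdge, Expr.eval, t1, t2, hxi, hyi]
    rw [hm]
    refine ⟨fun u hu w hw => ?_, fun a ha => ?_⟩
    · rw [matrix_succ]
      split_ifs with h
      · rcases h with ⟨rfl, rfl⟩ | ⟨rfl, rfl⟩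
        · by_cases he : baseA n m + (n * x i + y i) = baseA n m + (n * y i + x i)
          · rw [he, Function.update_self]
          · rw [Function.update_of_ne he, Function.update_self]
        · rw [Function.update_self]
      · rw [Function.update_of_ne, Function.update_of_ne]
        · exact h3 u hu w hw
        · intro he
          obtain ⟨rfl, rfl⟩ := mul_add_inj hw hyn (Nat.add_left_cancel he)
          exact h (.inl ⟨rfl, rfl⟩)
        · intro he
          obtain ⟨rfl, rfl⟩ := mul_add_inj hw hxn (Nat.add_left_cancel he)
          exact h (.inr ⟨rfl, rfl⟩)
    · rw [Function.update_of_ne (by omega), Function.update_of_ne (by omega)]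
      exact h4 a ha

theorem main_spec {x y : ℕ → ℕ} (hσ : σ.mem 0 = n) (hσ1 : σ.mem 1 = m)
    (hL : ∀ w < n, ∀ j, 1 ≤ j → j ≤ 4 → σ.mem (1 + 4 * w + j) = L w j)
    (hL01 : ∀ w j, L w j = 0 ∨ L w j = 1)
    (hx : ∀ e < m, σ.mem (2 + 4 * n + 2 * e) = x e ∧ x e < n)
    (hy : ∀ e < m, σ.mem (2 + 4 * n + 2 * e + 1) = y e ∧ y e < n)
    (h0 : ∀ a, baseA n m ≤ a → σ.mem a = 0) :
    ((∃ N, Sol (matrix x y m) (drop L) n N) → (main.run σ).reg 0 = 1) ∧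
    ((¬ ∃ N, Sol (matrix x y m) (drop L) n N) → (main.run σ).reg 0 = 0) := by
  set σ₂ := setR (setR σ 1 n) 2 m with hσ₂
  have r1 : σ₂.reg 1 = n := (setR_ne _ _ (by decide)).trans (setR_self _ _ _)
  have r2 : σ₂.reg 2 = m := setR_self _ _ _
  have hrun : main.run σ = solve.run (setR (readEdges.run (dropOne.run σ₂)) 0 1) := by
    have e0 : (Expr.ld (.lit 0)).eval σ = n := hσ
    have e1 : (Expr.ld (.lit 1)).eval (setR σ 1 n) = m := hσ1
    rw [main, Cmd.run_seq, Cmd.run_seq, Cmd.run_seq, Cmd.run_seq, Cmd.run_seq]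
    rw [show (Cmd.set 1 (.ld (.lit 0))).run σ = setR σ 1 n by rw [Cmd.run, e0],
      show (Cmd.set 2 (.ld (.lit 1))).run (setR σ 1 n) = σ₂ by rw [Cmd.run, e1]]
    rfl
  rw [hrun]
  obtain ⟨d1, d2⟩ := dropOne_spec (σ := σ₂) r1 hL
  set σ₃ := dropOne.run σ₂ with hσ₃
  have r1' : σ₃.reg 1 = n := (Cmd.run_reg _ _ (by decide)).trans r1
  have r2' : σ₃.reg 2 = m := (Cmd.run_reg _ _ (by decide)).trans r2
  obtain ⟨e1, e2⟩ := readEdges_spec (σ := σ₃) (x := x) (y := y) r1' r2'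
    (fun e he => ⟨(d2 _ (by omega)).trans (hx e he).1, (hx e he).2⟩)
    (fun e he => ⟨(d2 _ (by omega)).trans (hy e he).1, (hy e he).2⟩)
    (fun a ha => (d2 a (by unfold baseA at ha; omega)).trans (h0 a ha))
  set σ₄ := readEdges.run σ₃ with hσ₄
  refine solve_spec (m := m) (matrix_symm x y m) (fun w _ j => ?_) (fun w _ h3 => ?_)
    ⟨?_, ?_, fun w hw j hj hj4 => ?_, e1⟩ (setR_self _ _ _)
  · unfold drop
    split_ifs
    · exact .inl rfl
    · exact hL01 w j
  · unfold drop at *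
    rw [if_neg (by omega)] at h3
    rw [if_pos ⟨rfl, h3⟩]
  · exact ((setR_ne _ _ (by decide)).trans (Cmd.run_reg _ _ (by decide))).trans r1'
  · exact ((setR_ne _ _ (by decide)).trans (Cmd.run_reg _ _ (by decide))).trans r2'
  · exact (e2 _ (by unfold baseA; omega)).trans (d1 w hw j hj hj4)

/-! ### The encoding of an instance -/

theorem length_flatMap_const {α : Type*} (f : α → List ℕ) (k : ℕ) (l : List α)
    (hf : ∀ x, (f x).length = k) : (l.flatMap f).length = k * l.length := by
  induction l with
  | nil => simp
  | cons x l ih => simp [ih, hf]; ring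

theorem getD_flatMap {α : Type*} (f : α → List ℕ) (k : ℕ) (l : List α)
    (hf : ∀ x, (f x).length = k) {i j : ℕ} (hi : i < l.length) (hj : j < k) :
    (l.flatMap f).getD (k * i + j) 0 = (f l[i]).getD j 0 := by
  induction l generalizing i with
  | nil => simp at hi
  | cons x l ih =>
    rw [List.flatMap_cons]
    cases i with
    | zero =>
      rw [List.getD_append _ _ _ _ (by rw [hf]; omega)]
      simp
    | succ i =>
      rw [List.getD_append_right _ _ _ _ (by rw [hf, Nat.mul_add]; omega), hf,
        show k * (i + 1) + j - k = k * i + j by rw [Nat.mul_add]; omega,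
        ih (by simpa using hi)]
      simp

variable {I : StubbornInstance (Fin n)} {es : List (Fin n × Fin n)}

theorem encode_list (w : Fin n) {j : ℕ} (hj : 1 ≤ j) (hj4 : j ≤ 4) :
    (I.encode es).getD (1 + 4 * w + j) 0 = if j ∈ I.lists w then 1 else 0 := by
  have hlen : ∀ v : Fin n, ([1, 2, 3, 4].map fun k => if k ∈ I.lists v then 1 else 0).length = 4 :=
    fun _ => rfl
  unfold StubbornInstance.encode
  rw [List.getD_append _ _ _ _ (by
      simp only [List.length_append, length_flatMap_const _ 4 _ hlen, List.length_finRange]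
      simp; omega),
    List.getD_append_right _ _ _ _ (by simp; omega),
    show 1 + 4 * (w : ℕ) + j - [n, es.length].length = 4 * w + (j - 1) by simp; omega,
    getD_flatMap _ 4 _ hlen (by simp) (by omega)]
  obtain ⟨j, rfl⟩ := Nat.exists_eq_add_of_le' hj
  have : j < 4 := by omega
  interval_cases j <;> simp

theorem encode_edge {e : ℕ} (he : e < es.length) {j : ℕ} (hj : j < 2) :
    (I.encode es).getD (2 + 4 * n + 2 * e + j) 0 =
      [((es[e]).1 : ℕ), ((es[e]).2 : ℕ)].getD j 0 := by
  have hlen : ∀ v : Fin n, ([1, 2, 3, 4].map fun k => if k ∈ I.lists v then 1 else 0).length = 4 :=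
    fun _ => rfl
  unfold StubbornInstance.encode
  rw [List.getD_append_right _ _ _ _ (by
      simp only [List.length_append, length_flatMap_const _ 4 _ hlen, List.length_finRange]
      simp; omega)]
  simp only [List.length_append, length_flatMap_const _ 4 _ hlen, List.length_finRange]
  rw [show 2 + 4 * n + 2 * e + j - ([n, es.length].length + 4 * n) = 2 * e + j by simp; omega,
    getD_flatMap _ 2 _ (fun _ => rfl) he hj]

theorem encode_length : (I.encode es).length = baseA n es.length := by
  have hlen : ∀ v : Fin n, ([1, 2, 3, 4].map fun k => if k ∈ I.lists v then 1 else 0).length = 4 :=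
    fun _ => rfl
  unfold StubbornInstance.encode
  simp only [List.length_append, length_flatMap_const _ 4 _ hlen, List.length_finRange]
  rw [length_flatMap_const _ 2 _ fun _ => rfl]
  rfl

theorem length_le_size (h : I.IsEdgeList es) : n + es.length ≤ I.size := by
  have hs : I.graph.edgeSet = ((es.map fun e => s(e.1, e.2)).toFinset : Set (Sym2 (Fin n))) := by
    ext e
    rw [← h.2 e]
    simp
  unfold StubbornInstance.size
  rw [hs, Set.ncard_coe_finset, List.toFinset_card_of_nodup h.1, List.length_map]

theorem encode_le (h : I.IsEdgeList es) (a : ℕ) : (I.encode es).getD a 0 ≤ I.size + 2 := by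
  have hsz := length_le_size h
  have hall : ∀ x ∈ I.encode es, x ≤ I.size + 2 := by
    intro x hx
    simp only [StubbornInstance.encode, List.mem_append, List.mem_flatMap, List.mem_map,
      List.mem_cons, List.not_mem_nil, or_false] at hx
    rcases hx with ((rfl | rfl) | ⟨v, _, k, _, rfl⟩) | ⟨e, _, rfl | rfl⟩
    · omega
    · omega
    · split_ifs <;> omega
    · have := e.1.isLt; omega
    · have := e.2.isLt; omega
  by_cases ha : a < (I.encode es).length
  · rw [List.getD_eq_getElem _ _ ha]
    exact hall _ (List.getElem_mem ha)
  · rw [List.getD_eq_default _ _ (by omega)]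
    omega

/-- The lists of an instance as a matrix. -/
def listMatrix (I : StubbornInstance (Fin n)) (w j : ℕ) : ℕ :=
  if h : w < n then (if j ∈ I.lists ⟨w, h⟩ then 1 else 0) else 0

/-- The number of an end of an edge. -/
def fstEnd (es : List (Fin n × Fin n)) (e : ℕ) : ℕ := if h : e < es.length then es[e].1 else 0

def sndEnd (es : List (Fin n × Fin n)) (e : ℕ) : ℕ := if h : e < es.length then es[e].2 else 0

theorem matrix_eq_one (h : I.IsEdgeList es) (u w : Fin n) :
    matrix (fstEnd es) (sndEnd es) es.length u w = 1 ↔ I.graph.Adj u w := by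
  rw [← SimpleGraph.mem_edgeSet, ← h.2]
  simp only [matrix, List.mem_map, ite_eq_left_iff, zero_ne_one, imp_false, not_not]
  constructor
  · rintro ⟨e, he, h'⟩
    simp only [fstEnd, sndEnd, he, dif_pos, Fin.val_inj] at h'
    refine ⟨es[e], List.getElem_mem he, ?_⟩
    rw [Sym2.eq_iff]
    exact h'
  · rintro ⟨p, hp, h'⟩
    obtain ⟨e, he, rfl⟩ := List.getElem_of_mem hp
    refine ⟨e, he, ?_⟩
    simp only [fstEnd, sndEnd, he, dif_pos, Fin.val_inj]
    exact Sym2.eq_iff.1 h'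

theorem image_pair_ne {V : Type*} (φ : V → ℕ) (u w : V) :
    (φ '' {u, w} ≠ {1} ∧ φ '' {u, w} ≠ {2} ∧ φ '' {u, w} ≠ {1, 3}) ↔ ¬ Conf 1 (φ u) (φ w) := by
  have hs : ∀ a b c : ℕ, ({a, b} : Set ℕ) = {c} ↔ a = c ∧ b = c := fun a b c => by
    constructor
    · intro h
      have ha : a ∈ ({c} : Set ℕ) := h ▸ Set.mem_insert a {b}
      have hb : b ∈ ({c} : Set ℕ) := h ▸ Set.mem_insert_of_mem a rfl
      exact ⟨ha, hb⟩
    · rintro ⟨rfl, rfl⟩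
      simp
  rw [Set.image_pair, ne_eq, ne_eq, ne_eq, hs, hs, Set.pair_eq_pair_iff, Conf]
  omega

/-- Forwards, all vertices of colour 1 with 3 on their list are recoloured 3 simultaneously: a new
pair {1, 3} on an edge would come from {1} or {1, 3}. Backwards, the reduced lists are contained in
the original ones. -/
theorem solvable_iff (h : I.IsEdgeList es) : I.Solvable ↔
    ∃ N, Sol (matrix (fstEnd es) (sndEnd es) es.length) (drop (listMatrix I)) n N := by
  have hmem : ∀ (v : Fin n) (j : ℕ), listMatrix I v j = 1 ↔ j ∈ I.lists v := fun v j => by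
    simp [listMatrix]
  have hrange : ∀ (v : Fin n) (j : ℕ), j ∈ I.lists v → 1 ≤ j ∧ j ≤ 4 := fun v j hj => by
    have := I.lists_subset v hj
    simp only [Finset.mem_insert, Finset.mem_singleton] at this
    omega
  constructor
  · rintro ⟨φ, hl, hc, hf⟩
    set N : ℕ → ℕ := fun w => if hw : w < n then
      (if φ ⟨w, hw⟩ = 1 ∧ 3 ∈ I.lists ⟨w, hw⟩ then 3 else φ ⟨w, hw⟩) else 0 with hN
    have hNv : ∀ v : Fin n, N v = if φ v = 1 ∧ 3 ∈ I.lists v then 3 else φ v := fun v => by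
      simp [hN]
    refine ⟨N, fun u hu => ?_, fun u hu w hw huw => ?_⟩
    · lift u to Fin n using hu
      have := hrange u _ (hl u)
      rw [hNv]
      split_ifs with h1
      · exact ⟨by omega, by omega, by simp [drop, hmem, h1.2]⟩
      · refine ⟨this.1, this.2, ?_⟩
        unfold drop
        rw [if_neg (fun h' => h1 ⟨h'.1, (hmem u 3).1 h'.2⟩), hmem]
        exact hl u
    · lift u to Fin n using hu
      lift w to Fin n using hw
      have hne : u ≠ w := fun h => huw (by rw [h])
      rw [hNv, hNv]
      by_cases hadj : I.graph.Adj u w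
      · rw [(matrix_eq_one h u w).2 hadj]
        have := (image_pair_ne φ u w).1 (hf u w hadj)
        unfold Conf at *
        split_ifs <;> omega
      · have h4 : ¬ (φ u = 4 ∧ φ w = 4) := fun h' => hadj (hc h'.1 h'.2 hne)
        rintro (⟨h1, _⟩ | ⟨_, h1, h2⟩)
        · exact hadj ((matrix_eq_one h u w).1 h1)
        · split_ifs at h1 h2 <;> omega
  · rintro ⟨N, hN, hN'⟩
    refine ⟨fun v => N v, fun v => ?_, fun u hu w hw huw => ?_, fun u w huw => ?_⟩
    · have := (hN v v.isLt).2.2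
      unfold drop at this
      split_ifs at this
      exact (hmem v _).1 this
    · by_contra hadj
      refine hN' u u.isLt w w.isLt (fun h => huw (Fin.ext h)) (.inr ⟨fun h1 => ?_, hu, hw⟩)
      exact hadj ((matrix_eq_one h u w).1 h1)
    · rw [image_pair_ne (fun v : Fin n => N v), ← (matrix_eq_one h u w).2 huw]
      exact hN' u u.isLt w w.isLt (fun h => huw.ne (Fin.ext h))

theorem main_correct (h : I.IsEdgeList es) :
    (I.Solvable → (main.run (RAM.init (I.encode es))).reg 0 = 1) ∧
    (¬ I.Solvable → (main.run (RAM.init (I.encode es))).reg 0 = 0) := by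
  rw [solvable_iff h]
  refine main_spec (m := es.length) rfl rfl (fun w hw j hj hj4 => ?_) (fun w j => ?_)
    (fun e he => ⟨?_, ?_⟩) (fun e he => ⟨?_, ?_⟩) (fun a ha => ?_)
  · have := encode_list (I := I) (es := es) ⟨w, hw⟩ hj hj4
    simpa [RAM.init, listMatrix, hw] using this
  · unfold listMatrix
    split_ifs <;> simp
  · have := encode_edge (I := I) he (show 0 < 2 by omega)
    simpa [RAM.init, fstEnd, he] using this
  · simp [fstEnd, he]
  · have := encode_edge (I := I) he (show 1 < 2 by omega)
    simpa [RAM.init, sndEnd, he] using this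
  · simp [sndEnd, he]
  · exact List.getD_eq_default _ _ (by rw [encode_length]; exact ha)

theorem init_wt (h : I.IsEdgeList es) : WT (I.size + 2) types (RAM.init (I.encode es)) := by
  refine ⟨fun i => Nat.zero_le _, fun a => (encode_le h a).trans ?_⟩
  simp only [bd, pow_one]
  omega

theorem bd_isBigO (C : ℕ) : Asymptotics.IsBigO Filter.atTop
    (fun N : ℕ => ((bd (N + 2) (C, 7) : ℕ) : ℝ)) (fun N : ℕ => (N : ℝ) ^ 7) := by
  -- The factor 3 ^ 7 comes from N + 2 ≤ 3 * N for N ≥ 1.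
  refine Asymptotics.IsBigO.of_bound (C * 3 ^ 7) ?_
  filter_upwards [Filter.eventually_ge_atTop 1] with N hN
  rw [Real.norm_of_nonneg (by positivity), Real.norm_of_nonneg (by positivity)]
  have : bd (N + 2) (C, 7) ≤ C * 3 ^ 7 * N ^ 7 := by
    unfold bd
    rw [mul_assoc, ← mul_pow]
    exact Nat.mul_le_mul_left _ (Nat.pow_le_pow_left (by omega) _)
  exact_mod_cast this

end Stub

theorem mainTheorem4 :
    ∃ (P : RAM.Prog) (T : ℕ → ℕ) (c : ℕ),
      Asymptotics.IsBigO Filter.atTop (fun N : ℕ => (T N : ℝ)) (fun N : ℕ => (N : ℝ) ^ 7) ∧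
      ∀ (n : ℕ) (I : StubbornInstance (Fin n)) (es : List (Fin n × Fin n)),
        I.IsEdgeList es →
        ∃ (t : ℕ) (s : RAM.State),
          RAM.Exec ((I.size + 2) ^ c) P (RAM.init (I.encode es)) t s ∧
          t ≤ T I.size ∧
          (I.Solvable → s.reg 0 = 1) ∧ (¬ I.Solvable → s.reg 0 = 0) := by
  -- Here K is |G| + 2, so the word size K ^ 40 of `Cmd.simulates` gives c = 40. The answer,
  -- variable 0, is held by register 2 * 0.
  refine ⟨Stub.main.code 0, fun N => BL.bd (N + 2) ((Stub.main.cost Stub.types).1, 7), 40,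
    Stub.bd_isBigO _, fun n I es h => ?_⟩
  obtain ⟨t, s, he, ht, hr, _⟩ := Stub.main.simulates (K := I.size + 2) (by omega)
    Stub.main_check (Stub.init_wt h) (RAM.init (I.encode es)) ⟨fun _ => rfl, rfl⟩ 0
  have h0 := hr.1 0
  rw [Nat.mul_zero] at h0
  refine ⟨t, s, he, ?_, ?_⟩
  · rw [← Stub.main_cost]
    exact ht
  · rw [h0]
    exact Stub.main_correct h
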